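/- Let $A_1$ be the complex single-mode Weyl algebra, that is, the associative unital $\mathbb{C}$-algebra generated by $a$ and $a^\dagger$ subject to $[a,a^\dagger]=1$, and let $p\mapsto p^\dagger$ be the conjugate-linear anti-automorphism of $A_1$ that exchanges $a$ and $a^\dagger$. Let $\hat A_1=\{p\in A_1 : p^\dagger=-p\}$ be the skew-hermitian Weyl algebra, a real Lie algebra under the commutator. A finite-dimensional real Lie algebra $\mathfrak g$ can be faithfully realized in $\hat A_1$ if there is an injective homomorphism of real Lie algebras $\mathfrak g\to\hat A_1$. Then, up to isomorphism, $\mathfrak{sl}(2,\mathbb{R})$ is the only nonzero semisimple Lie algebra that can be faithfully realized in $\hat A_1$: a finite-dimensional real Lie algebra $\mathfrak g$ is nonzero, semisimple and faithfully realizable in $\hat A_1$ if and only if $\mathfrak g\cong\mathfrak{sl}(2,\mathbb{R})$. In particular, $\mathfrak{sl}(2,\mathbb{R})$ can be faithfully realized in $\hat A_1$, whereas neither $\mathfrak{su}(2)$ nor $\mathfrak{sl}(2,\mathbb{C})$ viewed as a real Lie algebra can be. -/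

import Mathlib

attribute [local instance] LieRing.ofAssociativeRing

/-- The two generators of the single-mode Weyl algebra: the annihilation operator `a` and the
creation operator `a†`. -/
inductive WeylGen : Type
  | ann : WeylGen
  | cre : WeylGen

/-- The canonical commutation relation `a a† = a† a + 1`, that is `[a, a†] = 1`. -/
inductive WeylRel : FreeAlgebra ℂ WeylGen → FreeAlgebra ℂ WeylGen → Prop
  | ccr : WeylRel (FreeAlgebra.ι ℂ WeylGen.ann * FreeAlgebra.ι ℂ WeylGen.cre)
      (FreeAlgebra.ι ℂ WeylGen.cre * FreeAlgebra.ι ℂ WeylGen.ann + 1)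

/-- The complex single-mode Weyl algebra `A₁`: the associative unital complex algebra generated by
`a` and `a†` subject to `[a, a†] = 1`. -/
def WeylAlgebra : Type := RingQuot WeylRel

namespace WeylAlgebra

noncomputable instance : Ring WeylAlgebra := inferInstanceAs (Ring (RingQuot WeylRel))

noncomputable instance : Algebra ℂ WeylAlgebra := inferInstanceAs (Algebra ℂ (RingQuot WeylRel))

/-- The projection of the free algebra on `a`, `a†` onto the Weyl algebra. -/
noncomputable def mk : FreeAlgebra ℂ WeylGen →ₐ[ℂ] WeylAlgebra :=
  RingQuot.mkAlgHom ℂ WeylRel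

/-- The universal property of the Weyl algebra. -/
noncomputable def lift {B : Type*} [Ring B] [Algebra ℂ B] (f : FreeAlgebra ℂ WeylGen →ₐ[ℂ] B)
    (h : ∀ ⦃x y⦄, WeylRel x y → f x = f y) : WeylAlgebra →ₐ[ℂ] B :=
  RingQuot.liftAlgHom ℂ ⟨f, h⟩

theorem lift_mk {B : Type*} [Ring B] [Algebra ℂ B] (f : FreeAlgebra ℂ WeylGen →ₐ[ℂ] B)
    (h : ∀ ⦃x y⦄, WeylRel x y → f x = f y) (x : FreeAlgebra ℂ WeylGen) :
    lift f h (mk x) = f x :=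
  RingQuot.liftAlgHom_mkAlgHom_apply ℂ f h x

/-- The image of a generator in the Weyl algebra. -/
noncomputable def gen (g : WeylGen) : WeylAlgebra :=
  mk (FreeAlgebra.ι ℂ g)

/-- The annihilation operator `a`. -/
noncomputable def a : WeylAlgebra := gen WeylGen.ann

/-- The creation operator `a†`. -/
noncomputable def aDag : WeylAlgebra := gen WeylGen.cre

theorem a_mul_aDag : a * aDag = aDag * a + 1 := by
  have h : mk _ = mk _ := RingQuot.mkAlgHom_rel ℂ WeylRel.ccr
  simpa [a, aDag, gen] using h

/-- The value of the dagger on the generators: it exchanges `a` and `a†`. -/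
noncomputable def daggerGen : WeylGen → WeylAlgebraᵐᵒᵖ
  | WeylGen.ann => MulOpposite.op aDag
  | WeylGen.cre => MulOpposite.op a

/-- The opposite of the Weyl algebra, as a complex algebra whose scalars act through complex
conjugation. Algebra homomorphisms into it are the conjugate-linear anti-homomorphisms. -/
@[reducible] noncomputable def conjOpAlgebra : Algebra ℂ WeylAlgebraᵐᵒᵖ :=
  Algebra.compHom WeylAlgebraᵐᵒᵖ (starRingEnd ℂ)

/-- The dagger as an algebra homomorphism to the opposite algebra with conjugated scalars. -/
noncomputable def daggerAlgHom :
    @AlgHom ℂ WeylAlgebra WeylAlgebraᵐᵒᵖ _ _ _ _ conjOpAlgebra :=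
  letI : Algebra ℂ WeylAlgebraᵐᵒᵖ := conjOpAlgebra
  lift (FreeAlgebra.lift ℂ daggerGen) (by
    rintro _ _ ⟨⟩
    simp only [map_mul, map_add, map_one, FreeAlgebra.lift_ι_apply, daggerGen]
    rw [← MulOpposite.op_mul, ← MulOpposite.op_mul, a_mul_aDag, MulOpposite.op_add,
      MulOpposite.op_one])

/-- The underlying ring homomorphism of the dagger, from `A₁` to its opposite ring. -/
noncomputable def daggerHom : WeylAlgebra →+* WeylAlgebraᵐᵒᵖ :=
  @AlgHom.toRingHom ℂ WeylAlgebra WeylAlgebraᵐᵒᵖ _ _ _ _ conjOpAlgebra daggerAlgHom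

theorem daggerHom_gen (g : WeylGen) : daggerHom (gen g) = daggerGen g := by
  let _ : Algebra ℂ WeylAlgebraᵐᵒᵖ := conjOpAlgebra
  change daggerAlgHom (gen g) = daggerGen g
  simp only [daggerAlgHom, gen]
  rw [lift_mk, FreeAlgebra.lift_ι_apply]

theorem daggerHom_algebraMap (c : ℂ) :
    daggerHom (algebraMap ℂ WeylAlgebra c) =
      MulOpposite.op (algebraMap ℂ WeylAlgebra (starRingEnd ℂ c)) := by
  let _ : Algebra ℂ WeylAlgebraᵐᵒᵖ := conjOpAlgebra
  exact daggerAlgHom.commutes c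

/-- The dagger is an involution. -/
theorem daggerHom_daggerHom (p : WeylAlgebra) :
    (daggerHom (daggerHom p).unop).unop = p := by
  let F : WeylAlgebra →ₐ[ℂ] WeylAlgebra :=
    { toFun := fun p => (daggerHom (daggerHom p).unop).unop
      map_one' := by simp
      map_mul' := by simp
      map_zero' := by simp
      map_add' := by simp
      commutes' := fun c => by simp [daggerHom_algebraMap] }
  have hF : F = AlgHom.id ℂ WeylAlgebra := by
    refine RingQuot.ringQuot_ext' ℂ F (AlgHom.id ℂ WeylAlgebra) ?_
    apply FreeAlgebra.hom_ext
    funext g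
    change (daggerHom (daggerHom (gen g)).unop).unop = gen g
    cases g <;> simp [daggerHom_gen, daggerGen, a, aDag]
  exact DFunLike.congr_fun hF p

/-- The dagger operation `p ↦ p†`: the conjugate-linear anti-automorphism of `A₁` that exchanges
`a` and `a†`. It is written `star`. -/
noncomputable instance : StarRing WeylAlgebra where
  star p := (daggerHom p).unop
  star_involutive := daggerHom_daggerHom
  star_mul p q := by simp
  star_add p q := by simp

theorem star_a : star a = aDag := by
  change (daggerHom (gen WeylGen.ann)).unop = aDag
  rw [daggerHom_gen]; rfl

theorem star_aDag : star aDag = a := by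
  change (daggerHom (gen WeylGen.cre)).unop = a
  rw [daggerHom_gen]; rfl

noncomputable instance : StarModule ℂ WeylAlgebra where
  star_smul c p := by
    change (daggerHom (c • p)).unop = star c • (daggerHom p).unop
    rw [Algebra.smul_def, map_mul, daggerHom_algebraMap, MulOpposite.unop_mul,
      MulOpposite.unop_op, ← Algebra.commutes, ← Algebra.smul_def]
    rfl

end WeylAlgebra

/-- The skew-hermitian Weyl algebra `Â₁`: the real Lie algebra of all `p ∈ A₁` with `p† = -p`,
with the commutator as Lie bracket. -/
noncomputable def SkewWeyl : LieSubalgebra ℝ WeylAlgebra where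
  carrier := {p | star p = -p}
  zero_mem' := by simp
  add_mem' := by
    intro p q hp hq
    simp only [Set.mem_ofPred_eq] at hp hq ⊢
    rw [star_add, hp, hq, neg_add]
  smul_mem' := by
    intro c p hp
    simp only [Set.mem_ofPred_eq] at hp ⊢
    rw [← Complex.coe_smul, star_smul, hp]
    simp
  lie_mem' := by
    intro p q hp hq
    change star p = -p at hp
    change star q = -q at hq
    change star ⁅p, q⁆ = -⁅p, q⁆
    rw [LieRing.of_associative_ring_bracket, star_sub, star_mul, star_mul, hp, hq]
    simp

/-- A faithful realization of a real Lie algebra `𝔤` in `Â₁` is a homomorphism of real Lie algebras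
from `𝔤` to `Â₁` that is an isomorphism onto its image, that is, injective. -/
def FaithfullyRealizable (𝔤 : Type*) [LieRing 𝔤] [LieAlgebra ℝ 𝔤] : Prop :=
  ∃ Φ : 𝔤 →ₗ⁅ℝ⁆ SkewWeyl, Function.Injective Φ

/-- `sl(2, ℝ)`: the real traceless `2 × 2` matrices. -/
abbrev SL2R : LieSubalgebra ℝ (Matrix (Fin 2) (Fin 2) ℝ) :=
  LieAlgebra.SpecialLinear.sl (Fin 2) ℝ

/-- `sl(2, ℂ)`, the complex traceless `2 × 2` matrices, viewed as a real Lie algebra. -/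
def SL2C : LieSubalgebra ℝ (Matrix (Fin 2) (Fin 2) ℂ) where
  carrier := {M | M.trace = 0}
  zero_mem' := by simp
  add_mem' := by
    intro M N hM hN
    simp only [Set.mem_ofPred_eq] at hM hN ⊢
    rw [Matrix.trace_add, hM, hN, add_zero]
  smul_mem' := by
    intro c M hM
    simp only [Set.mem_ofPred_eq] at hM ⊢
    rw [Matrix.trace_smul, hM, smul_zero]
  lie_mem' := by
    intro M N _ _
    change (⁅M, N⁆ : Matrix (Fin 2) (Fin 2) ℂ).trace = 0
    rw [LieRing.of_associative_ring_bracket, Matrix.trace_sub, Matrix.trace_mul_comm, sub_self]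

/-- `su(2)`: the real Lie algebra of traceless skew-hermitian complex `2 × 2` matrices. -/
def SU2 : LieSubalgebra ℝ (Matrix (Fin 2) (Fin 2) ℂ) where
  carrier := {M | M.conjTranspose = -M ∧ M.trace = 0}
  zero_mem' := by simp
  add_mem' := by
    rintro M N ⟨hM, hM'⟩ ⟨hN, hN'⟩
    refine ⟨?_, ?_⟩
    · rw [Matrix.conjTranspose_add, hM, hN, neg_add]
    · rw [Matrix.trace_add, hM', hN', add_zero]
  smul_mem' := by
    rintro c M ⟨hM, hM'⟩
    refine ⟨?_, ?_⟩
    · rw [Matrix.conjTranspose_smul, hM, star_trivial, smul_neg]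
    · rw [Matrix.trace_smul, hM', smul_zero]
  lie_mem' := by
    rintro M N ⟨hM, _⟩ ⟨hN, _⟩
    change (⁅M, N⁆ : Matrix (Fin 2) (Fin 2) ℂ).conjTranspose = -⁅M, N⁆ ∧
      (⁅M, N⁆ : Matrix (Fin 2) (Fin 2) ℂ).trace = 0
    refine ⟨?_, ?_⟩
    · rw [LieRing.of_associative_ring_bracket, Matrix.conjTranspose_sub,
        Matrix.conjTranspose_mul, Matrix.conjTranspose_mul, hM, hN]
      simp
    · rw [LieRing.of_associative_ring_bracket, Matrix.trace_sub, Matrix.trace_mul_comm, sub_self]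

/-! Two features of A₁ limit its Lie subalgebras: it is small, and its dagger is positive.

Smallness. Normally ordered monomials of degree below d span at most d² dimensions, so three
elements always satisfy a relation between their ordered monomials (`exists_linear_relation`).
Suppose [h, e] = 2e with e ≠ 0 and z commutes with both. Splitting such a relation along the
eigenspaces of ad h, then moving powers of e across it, leaves a nonzero polynomial that kills z; as
A₁ is a domain over ℂ, z is a scalar (`mem_degLT_one_of_commute`). A realization of a semisimple
algebra extends injectively to the complexification, where this says that a root has no kernel on
the Cartan subalgebra. So the rank is one and the dimension three (`WeylAlgebra.finrank_eq_three`).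

In dimension three, an orthogonal basis for the Killing form has diagonal values with product -2τ² <
0. Either exactly one of them is negative, which gives sl(2, ℝ) (`nonempty_equiv_SL2R`), or all
three are, the compact case.

Positivity. In the compact case the Casimir element commutes with everything in the image, hence is
a scalar. Its negative is a sum of terms y y†, whose leading symbols cannot cancel, so each y is a
scalar too (`mem_degLT_one_of_sum_mul_star`), contradicting the brackets (`eq_zero_of_compact`).
This excludes su(2), hence also sl(2, ℂ), which contains it. Conversely, quadratic elements of A₁
realize sl(2, ℝ). -/

open Polynomial

namespace WeylAlgebra

/-! ### The filtration by total degree -/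

/-- The span of the normally ordered monomials of total degree less than `d`. -/
noncomputable def degLT (d : ℕ) : Submodule ℂ WeylAlgebra :=
  Submodule.span ℂ ((fun p : ℕ × ℕ => aDag ^ p.1 * a ^ p.2) '' {p | p.1 + p.2 < d})

theorem monomial_mem_degLT {i j d : ℕ} (h : i + j < d) : aDag ^ i * a ^ j ∈ degLT d :=
  Submodule.subset_span ⟨(i, j), h, rfl⟩

theorem degLT_mono {d e : ℕ} (h : d ≤ e) : degLT d ≤ degLT e :=
  Submodule.span_mono (Set.image_mono fun _ hp => lt_of_lt_of_le hp h)

theorem degLT_zero : degLT 0 = ⊥ := by simp [degLT]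

theorem degLT_induction {d : ℕ} {P : (x : WeylAlgebra) → x ∈ degLT d → Prop}
    (mon : ∀ i j (h : i + j < d), P (aDag ^ i * a ^ j) (monomial_mem_degLT h))
    (zero : P 0 (zero_mem _))
    (add : ∀ x y hx hy, P x hx → P y hy → P (x + y) (add_mem hx hy))
    (smul : ∀ (c : ℂ) x hx, P x hx → P (c • x) (Submodule.smul_mem _ c hx))
    {x : WeylAlgebra} (hx : x ∈ degLT d) : P x hx := by
  induction hx using Submodule.span_induction with
  | mem x h => obtain ⟨p, hp, rfl⟩ := h; exact mon _ _ hp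
  | zero => exact zero
  | add x y _ _ hx hy => exact add x y _ _ hx hy
  | smul c x _ hx => exact smul c x _ hx

theorem degLT_le {d : ℕ} {V : Submodule ℂ WeylAlgebra}
    (h : ∀ i j, i + j < d → aDag ^ i * a ^ j ∈ V) : degLT d ≤ V :=
  fun _ hx => degLT_induction (P := fun x _ => x ∈ V) h V.zero_mem
    (fun _ _ _ _ => V.add_mem) (fun c _ _ => V.smul_mem c) hx

/-- A crude bound suffices: only quadratic growth, against the cubic number of monomials in three
elements, is used. -/
theorem finrank_degLT_le (d : ℕ) : Module.finrank ℂ (degLT d) ≤ d * d := by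
  classical
  let s : Finset WeylAlgebra := (Finset.range d ×ˢ Finset.range d).image
    (fun p : ℕ × ℕ => aDag ^ p.1 * a ^ p.2)
  have h : degLT d ≤ Submodule.span ℂ (s : Set WeylAlgebra) := by
    refine degLT_le fun i j hij => Submodule.subset_span ?_
    simp only [s, Finset.coe_image]
    exact ⟨(i, j), by simp; omega, rfl⟩
  calc Module.finrank ℂ (degLT d) ≤ Module.finrank ℂ (Submodule.span ℂ (s : Set WeylAlgebra)) :=
        Submodule.finrank_mono h
    _ ≤ s.card := finrank_span_finset_le_card s
    _ ≤ (Finset.range d ×ˢ Finset.range d).card := Finset.card_image_le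
    _ = d * d := by simp

instance (d : ℕ) : FiniteDimensional ℂ (degLT d) := by
  refine FiniteDimensional.span_of_finite ℂ (Set.Finite.image _ ?_)
  refine ((Set.finite_Iio d).prod (Set.finite_Iio d)).subset fun p hp => ?_
  simp only [Set.mem_ofPred_eq] at hp
  constructor <;> simp <;> omega

theorem aDag_pow_mul_mem {d : ℕ} (i : ℕ) {x : WeylAlgebra} (hx : x ∈ degLT d) :
    aDag ^ i * x ∈ degLT (i + d) := by
  induction hx using degLT_induction with
  | mon k l h => rw [← mul_assoc, ← pow_add]; exact monomial_mem_degLT (by omega)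
  | zero => simp
  | add x y _ _ hx hy => rw [mul_add]; exact add_mem hx hy
  | smul c x _ hx => rw [mul_smul_comm]; exact Submodule.smul_mem _ _ hx

theorem mul_a_pow_mem {d : ℕ} (j : ℕ) {x : WeylAlgebra} (hx : x ∈ degLT d) :
    x * a ^ j ∈ degLT (d + j) := by
  induction hx using degLT_induction with
  | mon k l h => rw [mul_assoc, ← pow_add]; exact monomial_mem_degLT (by omega)
  | zero => simp
  | add x y _ _ hx hy => rw [add_mul]; exact add_mem hx hy
  | smul c x _ hx => rw [smul_mul_assoc]; exact Submodule.smul_mem _ _ hx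

theorem a_mul_aDag_pow (k : ℕ) : a * aDag ^ (k + 1) = aDag ^ (k + 1) * a + (k + 1 : ℂ) • aDag ^ k := by
  induction k with
  | zero => simpa using a_mul_aDag
  | succ k ih =>
    rw [pow_succ _ (k + 1), ← mul_assoc, ih, add_mul, mul_assoc, a_mul_aDag, smul_mul_assoc,
      ← pow_succ]
    push_cast
    rw [mul_add, mul_one, ← mul_assoc, add_smul (k + 1 : ℂ) 1, one_smul]
    abel

/-- Moving `a` past `aDag` costs only terms of smaller total degree, so the associated graded
algebra is commutative. -/
theorem commutator_mem_degLT (j k : ℕ) :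
    a ^ j * aDag ^ k - aDag ^ k * a ^ j ∈ degLT (j + k) := by
  induction j generalizing k with
  | zero => simp
  | succ j ih =>
    have e : a ^ (j + 1) * aDag ^ k - aDag ^ k * a ^ (j + 1) =
        a ^ j * (a * aDag ^ k - aDag ^ k * a) + (a ^ j * aDag ^ k - aDag ^ k * a ^ j) * a ^ 1 := by
      rw [pow_succ]; noncomm_ring
    rw [e]
    refine add_mem ?_ (degLT_mono (by omega) (mul_a_pow_mem 1 (ih k)))
    cases k with
    | zero => simp
    | succ k =>
      rw [a_mul_aDag_pow, add_sub_cancel_left, mul_smul_comm]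
      refine Submodule.smul_mem _ _ ?_
      rw [← sub_add_cancel (a ^ j * aDag ^ k) (aDag ^ k * a ^ j)]
      exact add_mem (degLT_mono (by omega) (ih k)) (monomial_mem_degLT (by omega))

theorem monomial_mul_monomial (i j k l : ℕ) :
    aDag ^ i * a ^ j * (aDag ^ k * a ^ l) - aDag ^ (i + k) * a ^ (j + l) ∈
      degLT (i + j + k + l) := by
  have e : aDag ^ i * a ^ j * (aDag ^ k * a ^ l) - aDag ^ (i + k) * a ^ (j + l) =
      aDag ^ i * (a ^ j * aDag ^ k - aDag ^ k * a ^ j) * a ^ l := by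
    rw [pow_add, pow_add]; noncomm_ring
  rw [e]
  exact degLT_mono (by omega) (mul_a_pow_mem l (aDag_pow_mul_mem i (commutator_mem_degLT j k)))

/-- The bounds are strict: degrees at most d - 1 and e - 1 add up to at most d + e - 2, whence the
shift by one in `hn`. -/
theorem mul_mem_degLT {d e n : ℕ} {x y : WeylAlgebra} (hx : x ∈ degLT d) (hy : y ∈ degLT e)
    (hn : d + e ≤ n + 1) : x * y ∈ degLT n := by
  induction hx using degLT_induction with
  | zero => simp
  | add x x' _ _ hx hx' => rw [add_mul]; exact add_mem hx hx'
  | smul c x _ hx => rw [smul_mul_assoc]; exact Submodule.smul_mem _ _ hx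
  | mon i j hij =>
    induction hy using degLT_induction with
    | zero => simp
    | add y y' _ _ hy hy' => rw [mul_add]; exact add_mem hy hy'
    | smul c y _ hy => rw [mul_smul_comm]; exact Submodule.smul_mem _ _ hy
    | mon k l hkl =>
      rw [← sub_add_cancel (aDag ^ i * a ^ j * (aDag ^ k * a ^ l)) (aDag ^ (i + k) * a ^ (j + l))]
      exact add_mem (degLT_mono (by omega) (monomial_mul_monomial i j k l))
        (monomial_mem_degLT (by omega))

theorem one_mem_degLT : (1 : WeylAlgebra) ∈ degLT 1 := by
  simpa using monomial_mem_degLT (i := 0) (j := 0) (d := 1) (by omega)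

theorem pow_mem_degLT {d : ℕ} {x : WeylAlgebra} (hx : x ∈ degLT (d + 1)) (n : ℕ) :
    x ^ n ∈ degLT (d * n + 1) := by
  induction n with
  | zero => simpa using one_mem_degLT
  | succ n ih => rw [pow_succ]; exact mul_mem_degLT ih hx (by rw [mul_add]; omega)

theorem mem_degLT_one_iff {x : WeylAlgebra} :
    x ∈ degLT 1 ↔ ∃ c : ℂ, algebraMap ℂ WeylAlgebra c = x := by
  constructor
  · intro hx
    induction hx using degLT_induction with
    | mon i j h => obtain ⟨rfl, rfl⟩ : i = 0 ∧ j = 0 := by omega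
                   exact ⟨1, by simp⟩
    | zero => exact ⟨0, by simp⟩
    | add x y _ _ hx hy => obtain ⟨c, rfl⟩ := hx; obtain ⟨d, rfl⟩ := hy; exact ⟨c + d, by simp⟩
    | smul c x _ hx => obtain ⟨d, rfl⟩ := hx; exact ⟨c * d, by simp [Algebra.smul_def]⟩
  · rintro ⟨c, rfl⟩
    rw [Algebra.algebraMap_eq_smul_one]
    exact Submodule.smul_mem _ _ one_mem_degLT

theorem mk_surjective : Function.Surjective mk := RingQuot.mkAlgHom_surjective ℂ WeylRel

theorem exists_mem_degLT (x : WeylAlgebra) : ∃ d, x ∈ degLT (d + 1) := by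
  obtain ⟨x, rfl⟩ := mk_surjective x
  induction x using FreeAlgebra.induction with
  | grade0 c => exact ⟨0, mem_degLT_one_iff.2 ⟨c, by simp⟩⟩
  | grade1 g =>
    refine ⟨1, ?_⟩
    cases g
    · simpa using! monomial_mem_degLT (i := 0) (j := 1) (d := 2) (by omega)
    · simpa using! monomial_mem_degLT (i := 1) (j := 0) (d := 2) (by omega)
  | mul x y hx hy =>
    obtain ⟨d, hx⟩ := hx
    obtain ⟨e, hy⟩ := hy
    exact ⟨d + e, by rw [map_mul]; exact mul_mem_degLT hx hy (by omega)⟩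
  | add x y hx hy =>
    obtain ⟨d, hx⟩ := hx
    obtain ⟨e, hy⟩ := hy
    exact ⟨max d e, by
      rw [map_add]; exact add_mem (degLT_mono (by omega) hx) (degLT_mono (by omega) hy)⟩

/-! ### The representation by differential operators -/

/-- The values of the Bargmann–Fock representation on the generators. -/
noncomputable def fockGen : WeylGen → Module.End ℂ ℂ[X]
  | WeylGen.ann => derivative
  | WeylGen.cre => LinearMap.mulLeft ℂ X

/-- The action of `A₁` on polynomials: `a` is the derivative and `a†` the multiplication by `X`. -/
noncomputable def fock : WeylAlgebra →ₐ[ℂ] Module.End ℂ ℂ[X] :=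
  lift (FreeAlgebra.lift ℂ fockGen) (by
    rintro _ _ ⟨⟩
    simp only [map_mul, map_add, map_one, FreeAlgebra.lift_ι_apply, fockGen]
    refine LinearMap.ext fun p => ?_
    simp [add_comm])

theorem fock_a : fock a = derivative := by
  rw [a, gen, fock, lift_mk, FreeAlgebra.lift_ι_apply]; rfl

theorem fock_aDag : fock aDag = LinearMap.mulLeft ℂ X := by
  rw [aDag, gen, fock, lift_mk, FreeAlgebra.lift_ι_apply]; rfl

theorem fock_monomial (i j : ℕ) (p : ℂ[X]) :
    fock (aDag ^ i * a ^ j) p = X ^ i * derivative^[j] p := by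
  rw [map_mul, map_pow, map_pow, fock_a, fock_aDag, Module.End.mul_apply, LinearMap.pow_mulLeft,
    LinearMap.mulLeft_apply, Module.End.pow_apply]

/-- Apply a relation to X ^ j in the Fock representation: terms with a higher power of `a` kill it,
those with a lower power vanish by induction, and the rest give j! X ^ i with distinct i. -/
theorem linearIndependent_monomial :
    LinearIndependent ℂ (fun p : ℕ × ℕ => aDag ^ p.1 * a ^ p.2) := by
  rw [linearIndependent_iff']
  intro s g hg
  suffices H : ∀ j i, (i, j) ∈ s → g (i, j) = 0 from fun p hp => H p.2 p.1 hp
  intro j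
  induction j using Nat.strong_induction_on with
  | _ j ih =>
  intro i hi
  have h1 := congrArg (fun x => (fock x (X ^ j)).coeff i) hg
  simp only [map_sum, map_smul, LinearMap.sum_apply, LinearMap.smul_apply, fock_monomial,
    finsetSum_coeff, coeff_smul, map_zero, LinearMap.zero_apply, coeff_zero] at h1
  rw [Finset.sum_eq_single (i, j)] at h1
  · rw [iterate_derivative_X_pow_eq_smul] at h1
    simpa [Nat.descFactorial_self, Nat.factorial_ne_zero] using h1
  · rintro ⟨k, l⟩ hp hne
    rcases lt_trichotomy l j with h | rfl | h
    · simp [ih l h k hp]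
    · have : i ≠ k := fun h => hne (by rw [h])
      rw [iterate_derivative_X_pow_eq_smul]
      simp [coeff_X_pow, this]
    · rw [iterate_derivative_X_pow_eq_smul]
      simp [Nat.descFactorial_eq_zero_iff_lt.2 h]
  · exact fun h => absurd hi h

/-! ### Symbols -/

/-- The normally ordered element with homogeneous symbol `∑ pₖ (a†)ᵏ aᵈ⁻ᵏ`. -/
noncomputable def ofSymbol (d : ℕ) : ℂ[X] →ₗ[ℂ] WeylAlgebra :=
  ∑ k ∈ Finset.range (d + 1), (lcoeff ℂ k).smulRight (aDag ^ k * a ^ (d - k))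

theorem ofSymbol_apply (d : ℕ) (p : ℂ[X]) :
    ofSymbol d p = ∑ k ∈ Finset.range (d + 1), p.coeff k • (aDag ^ k * a ^ (d - k)) := by
  simp [ofSymbol]

theorem ofSymbol_X_pow {d k : ℕ} (h : k ≤ d) : ofSymbol d (X ^ k) = aDag ^ k * a ^ (d - k) := by
  rw [ofSymbol_apply, Finset.sum_eq_single k]
  · simp
  · intro j _ hj; simp [coeff_X_pow, hj]
  · intro h'; simp at h'; omega

theorem ofSymbol_mem (d : ℕ) (p : ℂ[X]) : ofSymbol d p ∈ degLT (d + 1) := by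
  rw [ofSymbol_apply]
  refine Submodule.sum_mem _ fun k hk => Submodule.smul_mem _ _ (monomial_mem_degLT ?_)
  simp at hk; omega

/-- A homogeneous symbol of degree d in two variables is stored as its dehomogenization in one. The
degree bound is needed because `ofSymbol` ignores coefficients above d. -/
theorem eq_zero_of_ofSymbol_mem {d : ℕ} {p : ℂ[X]} (hp : p ∈ degreeLE ℂ d)
    (h : ofSymbol d p ∈ degLT d) : p = 0 := by
  have hd : Disjoint {q : ℕ × ℕ | q.1 + q.2 = d} {q | q.1 + q.2 < d} := by
    rw [Set.disjoint_left]; intro q hq hq'; simp at hq hq'; omega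
  have h1 : ofSymbol d p ∈ Submodule.span ℂ
      ((fun q : ℕ × ℕ => aDag ^ q.1 * a ^ q.2) '' {q | q.1 + q.2 = d}) := by
    rw [ofSymbol_apply]
    refine Submodule.sum_mem _ fun k hk => Submodule.smul_mem _ _ (Submodule.subset_span ?_)
    simp at hk
    exact ⟨(k, d - k), by simp; omega, rfl⟩
  have h2 := (Submodule.disjoint_def.1 (linearIndependent_monomial.disjoint_span_image hd)) _ h1 h
  have h3 : LinearIndependent ℂ (fun k : ℕ => aDag ^ k * a ^ (d - k)) :=
    linearIndependent_monomial.comp (fun k => (k, d - k)) fun k l h => (Prod.ext_iff.1 h).1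
  rw [ofSymbol_apply] at h2
  have h4 := linearIndependent_iff'.1 h3 _ _ h2
  ext k
  by_cases hk : k ≤ d
  · exact h4 k (by simp; omega)
  · exact coeff_eq_zero_of_degree_lt (lt_of_le_of_lt (mem_degreeLE.1 hp) (by simpa using hk))

theorem X_pow_mem_degreeLE {k d : ℕ} (h : k ≤ d) : (X ^ k : ℂ[X]) ∈ degreeLE ℂ d :=
  mem_degreeLE.2 ((degree_X_pow_le k).trans (by exact_mod_cast h))

theorem degreeLE_induction {d : ℕ} {P : (p : ℂ[X]) → p ∈ degreeLE ℂ d → Prop}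
    (mon : ∀ k (h : k ≤ d), P (X ^ k) (X_pow_mem_degreeLE h)) (zero : P 0 (zero_mem _))
    (add : ∀ x y hx hy, P x hx → P y hy → P (x + y) (add_mem hx hy))
    (smul : ∀ (c : ℂ) x hx, P x hx → P (c • x) (Submodule.smul_mem _ c hx))
    {p : ℂ[X]} (hp : p ∈ degreeLE ℂ d) : P p hp := by
  classical
  have hp' := hp
  rw [degreeLE_eq_span_X_pow] at hp'
  induction hp' using Submodule.span_induction with
  | mem x h =>
    simp only [Finset.coe_image, Set.mem_image, Finset.coe_range, Set.mem_Iio] at h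
    obtain ⟨k, hk, rfl⟩ := h
    exact mon k (by omega)
  | zero => exact zero
  | add x y hx' hy' hx hy =>
    rw [← degreeLE_eq_span_X_pow] at hx' hy'
    exact add x y _ _ (hx hx') (hy hy')
  | smul c x hx' hx =>
    rw [← degreeLE_eq_span_X_pow] at hx'
    exact smul c x _ (hx hx')

theorem ofSymbol_mul_ofSymbol {d e : ℕ} {p q : ℂ[X]} (hp : p ∈ degreeLE ℂ d)
    (hq : q ∈ degreeLE ℂ e) :
    ofSymbol d p * ofSymbol e q - ofSymbol (d + e) (p * q) ∈ degLT (d + e) := by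
  induction hp using degreeLE_induction with
  | zero => simp
  | add x y _ _ hx hy =>
    convert add_mem hx hy using 1
    rw [map_add, add_mul, add_mul, map_add]; abel
  | smul c x _ hx =>
    convert Submodule.smul_mem _ c hx using 1
    rw [map_smul, smul_mul_assoc, smul_mul_assoc, map_smul, smul_sub]
  | mon k hk =>
    induction hq using degreeLE_induction with
    | zero => simp
    | add x y _ _ hx hy =>
      convert add_mem hx hy using 1
      rw [map_add, mul_add, mul_add, map_add]; abel
    | smul c x _ hx =>
      convert Submodule.smul_mem _ c hx using 1
      rw [map_smul, mul_smul_comm, mul_smul_comm, map_smul, smul_sub]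
    | mon l hl =>
      rw [← pow_add, ofSymbol_X_pow hk, ofSymbol_X_pow hl, ofSymbol_X_pow (by omega),
        show d + e - (k + l) = d - k + (e - l) by omega]
      exact degLT_mono (by omega) (monomial_mul_monomial k (d - k) l (e - l))

/-- `p` is the symbol of `x` with respect to degree `d`. -/
def HasSymbol (d : ℕ) (x : WeylAlgebra) (p : ℂ[X]) : Prop :=
  p ∈ degreeLE ℂ d ∧ x - ofSymbol d p ∈ degLT d

theorem HasSymbol.mem {d : ℕ} {x : WeylAlgebra} {p : ℂ[X]} (h : HasSymbol d x p) :
    x ∈ degLT (d + 1) := by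
  rw [← sub_add_cancel x (ofSymbol d p)]
  exact add_mem (degLT_mono (by omega) h.2) (ofSymbol_mem d p)

theorem HasSymbol.eq_zero_iff {d : ℕ} {x : WeylAlgebra} {p : ℂ[X]} (h : HasSymbol d x p) :
    p = 0 ↔ x ∈ degLT d := by
  constructor
  · rintro rfl; simpa using h.2
  · intro hx
    refine eq_zero_of_ofSymbol_mem h.1 ?_
    simpa using sub_mem hx h.2

theorem HasSymbol.add {d : ℕ} {x y : WeylAlgebra} {p q : ℂ[X]} (hx : HasSymbol d x p)
    (hy : HasSymbol d y q) : HasSymbol d (x + y) (p + q) := by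
  refine ⟨add_mem hx.1 hy.1, ?_⟩
  rw [map_add, add_sub_add_comm]
  exact add_mem hx.2 hy.2

theorem HasSymbol.smul {d : ℕ} {x : WeylAlgebra} {p : ℂ[X]} (c : ℂ) (hx : HasSymbol d x p) :
    HasSymbol d (c • x) (c • p) := by
  refine ⟨Submodule.smul_mem _ _ hx.1, ?_⟩
  rw [map_smul, ← smul_sub]
  exact Submodule.smul_mem _ _ hx.2

/-- Reordering affects only lower degrees, so symbols multiply as commutative polynomials. -/
theorem HasSymbol.mul {d e : ℕ} {x y : WeylAlgebra} {p q : ℂ[X]} (hx : HasSymbol d x p)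
    (hy : HasSymbol e y q) : HasSymbol (d + e) (x * y) (p * q) := by
  refine ⟨?_, ?_⟩
  · rw [mem_degreeLE]
    calc (p * q).degree ≤ p.degree + q.degree := degree_mul_le p q
      _ ≤ (d : WithBot ℕ) + e := add_le_add (mem_degreeLE.1 hx.1) (mem_degreeLE.1 hy.1)
      _ = ((d + e : ℕ) : WithBot ℕ) := by push_cast; rfl
  · have e1 : x * y - ofSymbol (d + e) (p * q) =
        (x - ofSymbol d p) * y + ofSymbol d p * (y - ofSymbol e q) +
          (ofSymbol d p * ofSymbol e q - ofSymbol (d + e) (p * q)) := by noncomm_ring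
    rw [e1]
    exact add_mem (add_mem (mul_mem_degLT hx.2 hy.mem (by omega))
      (mul_mem_degLT (ofSymbol_mem d p) hy.2 (by omega))) (ofSymbol_mul_ofSymbol hx.1 hy.1)

theorem exists_hasSymbol {d : ℕ} {x : WeylAlgebra} (hx : x ∈ degLT (d + 1)) :
    ∃ p, HasSymbol d x p := by
  induction hx using degLT_induction with
  | zero => exact ⟨0, zero_mem _, by simp⟩
  | add x y _ _ hx hy =>
    obtain ⟨p, hp⟩ := hx
    obtain ⟨q, hq⟩ := hy
    exact ⟨p + q, hp.add hq⟩
  | smul c x _ hx => obtain ⟨p, hp⟩ := hx; exact ⟨c • p, hp.smul c⟩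
  | mon i j hij =>
    by_cases h : i + j = d
    · refine ⟨X ^ i, X_pow_mem_degreeLE (by omega), ?_⟩
      rw [ofSymbol_X_pow (by omega), show d - i = j by omega, sub_self]
      exact zero_mem _
    · exact ⟨0, zero_mem _, by simpa using monomial_mem_degLT (by omega)⟩

theorem exists_hasSymbol_ne_zero {x : WeylAlgebra} (hx : x ≠ 0) :
    ∃ d p, HasSymbol d x p ∧ p ≠ 0 := by
  classical
  have hex : ∃ d, x ∈ degLT d := let ⟨d, h⟩ := exists_mem_degLT x; ⟨d + 1, h⟩
  have h1 := Nat.find_spec hex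
  obtain h0 | ⟨d, hd⟩ : Nat.find hex = 0 ∨ ∃ d, Nat.find hex = d + 1 := by
    cases Nat.find hex <;> simp
  · rw [h0, degLT_zero] at h1; exact absurd (by simpa using h1) hx
  · rw [hd] at h1
    obtain ⟨p, hp⟩ := exists_hasSymbol h1
    refine ⟨d, p, hp, fun h => Nat.find_min hex (m := d) (by omega) (hp.eq_zero_iff.1 h)⟩

instance : Nontrivial WeylAlgebra :=
  ⟨1, 0, by simpa using linearIndependent_monomial.ne_zero (0, 0)⟩

/-- Nonzero leading symbols have a nonzero product in the domain ℂ[X]. -/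
instance : NoZeroDivisors WeylAlgebra where
  eq_zero_or_eq_zero_of_mul_eq_zero := by
    intro x y hxy
    by_contra! h
    obtain ⟨d, p, hp, hp0⟩ := exists_hasSymbol_ne_zero h.1
    obtain ⟨e, q, hq, hq0⟩ := exists_hasSymbol_ne_zero h.2
    exact mul_ne_zero hp0 hq0 ((hp.mul hq).eq_zero_iff.2 (hxy ▸ zero_mem _))

instance : IsDomain WeylAlgebra := NoZeroDivisors.to_isDomain _

/-! ### Positivity -/

theorem star_mem_degLT {d : ℕ} {x : WeylAlgebra} (hx : x ∈ degLT d) : star x ∈ degLT d := by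
  induction hx using degLT_induction with
  | zero => simp
  | add x y _ _ hx hy => rw [star_add]; exact add_mem hx hy
  | smul c x _ hx => rw [star_smul]; exact Submodule.smul_mem _ _ hx
  | mon i j h =>
    rw [star_mul, star_pow, star_pow, star_a, star_aDag]
    exact monomial_mem_degLT (by omega)

/-- The dagger turns the k-th monomial of degree d into the (d - k)-th and conjugates its
coefficient. -/
theorem star_ofSymbol (d : ℕ) (p : ℂ[X]) :
    star (ofSymbol d p) = ofSymbol d (reflect d (p.map (starRingEnd ℂ))) := by
  rw [ofSymbol_apply, ofSymbol_apply, star_sum, ← Finset.sum_range_reflect]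
  refine Finset.sum_congr rfl fun k hk => ?_
  have hk' : k ≤ d := by simp at hk; omega
  rw [star_smul, star_mul, star_pow, star_pow, star_a, star_aDag, coeff_reflect, revAt_le hk',
    coeff_map]
  simp [show d - (d - k) = k by omega]

theorem HasSymbol.star {d : ℕ} {x : WeylAlgebra} {p : ℂ[X]} (hx : HasSymbol d x p) :
    HasSymbol d (star x) (reflect d (p.map (starRingEnd ℂ))) := by
  refine ⟨?_, ?_⟩
  · rw [mem_degreeLE, degree_le_iff_coeff_zero]
    intro m hm
    have hm' : d < m := by exact_mod_cast hm
    rw [coeff_reflect, revAt_eq_self_of_lt hm', coeff_map,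
      coeff_eq_zero_of_degree_lt (lt_of_le_of_lt (mem_degreeLE.1 hx.1) hm), map_zero]
  · rw [← star_ofSymbol, ← star_sub]
    exact star_mem_degLT hx.2

theorem coeff_mul_reflect_conj {d : ℕ} {p : ℂ[X]} :
    (p * reflect d (p.map (starRingEnd ℂ))).coeff d =
      ((∑ k ∈ Finset.range (d + 1), ‖p.coeff k‖ ^ 2 : ℝ) : ℂ) := by
  rw [coeff_mul, Finset.Nat.sum_antidiagonal_eq_sum_range_succ_mk]
  push_cast
  refine Finset.sum_congr rfl fun k hk => ?_
  rw [Finset.mem_range] at hk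
  rw [coeff_reflect, revAt_le (by omega), coeff_map, show d - (d - k) = k by omega,
    Complex.mul_conj, Complex.normSq_eq_norm_sq]
  push_cast; rfl

/-- A sum of elements `xᵢ xᵢ†` is a scalar only if every `xᵢ` is. -/
theorem mem_degLT_one_of_sum_mul_star {ι : Type*} (s : Finset ι) (x : ι → WeylAlgebra)
    (h : ∑ i ∈ s, x i * star (x i) ∈ degLT 1) : ∀ i ∈ s, x i ∈ degLT 1 := by
  classical
  -- Descent on a common degree bound: for d ≥ 1 a scalar has zero symbol in degree 2d, while the
  -- middle coefficient of that symbol is the sum of all |coefficient|² of the `p i`.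
  have step : ∀ d, 1 ≤ d → (∀ i ∈ s, x i ∈ degLT (d + 1)) → ∀ i ∈ s, x i ∈ degLT d := by
    intro d hd hx
    have hp' : ∀ i, ∃ p, i ∈ s → HasSymbol d (x i) p := fun i => by
      by_cases hi : i ∈ s
      · obtain ⟨p, hp⟩ := exists_hasSymbol (hx i hi); exact ⟨p, fun _ => hp⟩
      · exact ⟨0, fun h => absurd h hi⟩
    choose p hp using hp'
    have key : HasSymbol (d + d) (∑ i ∈ s, x i * star (x i))
        (∑ i ∈ s, p i * reflect d ((p i).map (starRingEnd ℂ))) := by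
      have : ∀ t ⊆ s, HasSymbol (d + d) (∑ i ∈ t, x i * star (x i))
          (∑ i ∈ t, p i * reflect d ((p i).map (starRingEnd ℂ))) := by
        intro t
        induction t using Finset.induction_on with
        | empty => intro _; exact ⟨zero_mem _, by simp⟩
        | insert i t hi ih =>
          intro ht
          rw [Finset.sum_insert hi, Finset.sum_insert hi]
          have hi' := hp i (ht (Finset.mem_insert_self i t))
          exact (hi'.mul hi'.star).add (ih fun j hj => ht (Finset.mem_insert_of_mem hj))
      exact this s subset_rfl
    have h0 := congrArg (fun q => coeff q d)
      (key.eq_zero_iff.2 (degLT_mono (by omega) h))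
    simp only [finsetSum_coeff, coeff_mul_reflect_conj, coeff_zero] at h0
    have h1 : ∑ i ∈ s, ∑ k ∈ Finset.range (d + 1), ‖(p i).coeff k‖ ^ 2 = 0 := by
      exact_mod_cast h0
    rw [Finset.sum_eq_zero_iff_of_nonneg
      fun i _ => Finset.sum_nonneg fun k _ => by positivity] at h1
    intro i hi
    refine (hp i hi).eq_zero_iff.1 ?_
    have h2 := h1 i hi
    rw [Finset.sum_eq_zero_iff_of_nonneg fun k _ => by positivity] at h2
    ext k
    by_cases hk : k ≤ d
    · simpa using h2 k (by simp; omega)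
    · exact coeff_eq_zero_of_degree_lt
        (lt_of_le_of_lt (mem_degreeLE.1 (hp i hi).1) (by simpa using hk))
  choose n hn using fun i => exists_mem_degLT (x i)
  have : ∀ m, (∀ i ∈ s, x i ∈ degLT (m + 1)) → ∀ i ∈ s, x i ∈ degLT 1 := by
    intro m
    induction m with
    | zero => exact id
    | succ m ih => exact fun hx => ih (step (m + 1) (by omega) hx)
  refine this (s.sup n) fun i hi => degLT_mono ?_ (hn i)
  have := Finset.le_sup (f := n) hi
  omega

end WeylAlgebra

/-! ### Growth, and the centralizer of a nonabelian pair -/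

namespace WeylAlgebra

/-- In a domain the minimal polynomial is irreducible, hence linear over ℂ. -/
theorem mem_degLT_one_of_isAlgebraic {z : WeylAlgebra} (hz : IsAlgebraic ℂ z) : z ∈ degLT 1 := by
  have hi : IsIntegral ℂ z := hz.isIntegral
  have h1 := IsAlgClosed.degree_eq_one_of_irreducible ℂ (minpoly.irreducible hi)
  obtain ⟨c, hc⟩ := minpoly.mem_range_of_degree_eq_one ℂ z h1
  exact mem_degLT_one_iff.2 ⟨c, hc⟩

theorem mul_pow_eq_pow_mul {e h : WeylAlgebra} (he : h * e = e * (h + 2)) (k : ℕ) :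
    h * e ^ k = e ^ k * (h + (2 * k : ℂ) • 1) := by
  induction k with
  | zero => simp
  | succ k ih =>
    have h2 : (2 : WeylAlgebra) = (2 : ℂ) • 1 := by
      rw [← Algebra.algebraMap_eq_smul_one, map_ofNat]
    rw [pow_succ', ← mul_assoc, he, mul_assoc, add_mul, ih, h2, smul_mul_assoc, one_mul, mul_assoc]
    congr 1
    rw [mul_add, mul_add, mul_smul_comm, mul_smul_comm, mul_one]
    push_cast
    module

/-- Growth of the Weyl algebra: three elements have linearly dependent ordered monomials. -/
theorem exists_linear_relation (x y w : WeylAlgebra) : ∃ N, ¬ LinearIndependent ℂ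
    (fun p : Fin N × Fin N × Fin N => x ^ (p.1 : ℕ) * y ^ (p.2.1 : ℕ) * w ^ (p.2.2 : ℕ)) := by
  obtain ⟨d₁, h₁⟩ := exists_mem_degLT x
  obtain ⟨d₂, h₂⟩ := exists_mem_degLT y
  obtain ⟨d₃, h₃⟩ := exists_mem_degLT w
  set c := d₁ + d₂ + d₃ with hc
  -- The N³ monomials have degree at most cN, so they lie in a space of dimension at most ((c +
  -- 1)N)²; N is the first integer for which N³ exceeds this.
  set N := (c + 1) * (c + 1) + 1 with hN
  refine ⟨N, fun hli => ?_⟩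
  have hmem : ∀ p : Fin N × Fin N × Fin N,
      x ^ (p.1 : ℕ) * y ^ (p.2.1 : ℕ) * w ^ (p.2.2 : ℕ) ∈ degLT (c * N + 1) := by
    rintro ⟨i, j, k⟩
    refine degLT_mono (d := d₁ * i + d₂ * j + d₃ * k + 1) ?_
      (mul_mem_degLT (mul_mem_degLT (n := d₁ * i + d₂ * j + 1) (pow_mem_degLT h₁ i)
        (pow_mem_degLT h₂ j) (by omega)) (pow_mem_degLT h₃ k) (by omega))
    have := Nat.mul_le_mul_left d₁ i.2.le
    have := Nat.mul_le_mul_left d₂ j.2.le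
    have := Nat.mul_le_mul_left d₃ k.2.le
    have : c * N = d₁ * N + d₂ * N + d₃ * N := by rw [hc, add_mul, add_mul]
    omega
  have hli' : LinearIndependent ℂ (fun p => (⟨_, hmem p⟩ : degLT (c * N + 1))) :=
    LinearIndependent.of_comp (degLT (c * N + 1)).subtype hli
  have h1 := hli'.fintype_card_le_finrank.trans (finrank_degLT_le _)
  simp only [Fintype.card_prod, Fintype.card_fin] at h1
  have h2 : c * N + 1 ≤ (c + 1) * N := by rw [add_one_mul c N]; omega
  have h3 : N * (N * N) ≤ ((c + 1) * (c + 1)) * (N * N) :=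
    (h1.trans (Nat.mul_le_mul h2 h2)).trans (by rw [mul_mul_mul_comm])
  have h4 := Nat.le_of_mul_le_mul_right h3 (by positivity)
  omega

/-- An element commuting with a nonabelian pair `[h, e] = 2e` is a scalar. -/
theorem mem_degLT_one_of_commute {e h z : WeylAlgebra} (he0 : e ≠ 0) (he : h * e = e * (h + 2))
    (hze : Commute z e) (hzh : Commute z h) : z ∈ degLT 1 := by
  classical
  obtain ⟨N, hN⟩ := exists_linear_relation z h e
  obtain ⟨g, hg, ⟨i₀, j₀, k₀⟩, hne⟩ := Fintype.not_linearIndependent_iff.1 hN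
  let G : Fin N → Fin N → ℂ[X] := fun j k => ∑ i, C (g (i, j, k)) * X ^ (i : ℕ)
  have hG : ∀ j k, aeval z (G j k) = ∑ i, g (i, j, k) • z ^ (i : ℕ) := fun j k => by
    simp [G, Algebra.smul_def]
  let Q : Fin N → WeylAlgebra := fun k => ∑ j, aeval z (G j k) * h ^ (j : ℕ)
  have hqh : ∀ j k, Commute (aeval z (G j k)) h := fun j k => by
    rw [hG]
    exact Commute.sum_left _ _ _ fun i _ => ((hzh.pow_left i).smul_left _)
  have hqe : ∀ j k, Commute (aeval z (G j k)) e := fun j k => by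
    rw [hG]
    exact Commute.sum_left _ _ _ fun i _ => ((hze.pow_left i).smul_left _)
  have hQh : ∀ k, Commute (Q k) h := fun k =>
    Commute.sum_left _ _ _ fun j _ => (hqh j k).mul_left ((Commute.refl h).pow_left _)
  have hsum : ∑ k, Q k * e ^ (k : ℕ) = 0 := by
    rw [← hg]
    simp only [Q, hG, Finset.sum_mul, smul_mul_assoc]
    rw [Fintype.sum_prod_type, Finset.sum_congr rfl fun i _ => Fintype.sum_prod_type _,
      Finset.sum_congr rfl fun i _ => Finset.sum_comm, Finset.sum_comm]
    refine Finset.sum_congr rfl fun k _ => ?_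
    rw [Finset.sum_comm]
  -- Each `Q k * e ^ k` is an eigenvector of ad h for 2k or zero, so the terms of the relation
  -- vanish separately.
  have hind := Module.End.eigenspaces_iSupIndep
    (LinearMap.mulLeft ℂ h - LinearMap.mulRight ℂ h)
  have hind' := hind.comp (f := fun k : Fin N => (2 * (k : ℕ) : ℂ)) fun k l hkl => by
    simpa [Fin.ext_iff] using hkl
  have hQe := (iSupIndep_iff_finsetSum_eq_zero_imp_eq_zero _).1 hind' Finset.univ
    (fun k => Q k * e ^ (k : ℕ)) (fun k _ => by
      rw [Function.comp_apply, Module.End.mem_eigenspace_iff]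
      simp only [LinearMap.sub_apply, LinearMap.mulLeft_apply, LinearMap.mulRight_apply]
      rw [← mul_assoc, ← (hQh k).eq, mul_assoc, mul_pow_eq_pow_mul he, mul_add, mul_add,
        mul_smul_comm, mul_smul_comm, mul_one, mul_assoc, add_sub_cancel_left]) hsum k₀
      (Finset.mem_univ _)
  have hQ0 : Q k₀ = 0 := (mul_eq_zero.1 hQe).resolve_right (pow_ne_zero _ he0)
  -- shifting `h` by even integers
  have hshift : ∀ n : ℕ, ∑ j, aeval z (G j k₀) * (h + (2 * n : ℂ) • 1) ^ (j : ℕ) = 0 := by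
    intro n
    have h1 : ∀ j : ℕ, h ^ j * e ^ n = e ^ n * (h + (2 * n : ℂ) • 1) ^ j := fun j => by
      have : SemiconjBy (e ^ n) (h + (2 * n : ℂ) • 1) h := (mul_pow_eq_pow_mul he n).symm
      exact (this.pow_right j).eq.symm
    have h2 : e ^ n * ∑ j, aeval z (G j k₀) * (h + (2 * n : ℂ) • 1) ^ (j : ℕ) = 0 := by
      rw [← zero_mul (e ^ n), ← hQ0, Finset.mul_sum, Finset.sum_mul]
      refine Finset.sum_congr rfl fun j _ => ?_
      rw [mul_assoc, h1, ← mul_assoc, ← mul_assoc, ((hqe j k₀).pow_right n).eq]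
    exact (mul_eq_zero.1 h2).resolve_left (pow_ne_zero _ he0)
  have hcomm : ∀ x ∈ ({z, h} : Set WeylAlgebra), ∀ y ∈ ({z, h} : Set WeylAlgebra),
      x * y = y * x := by
    rintro x (rfl | rfl) y (rfl | rfl)
    · rfl
    · exact hzh
    · exact hzh.symm
    · rfl
  -- In this commutative domain a polynomial with the infinitely many roots h + 2n is zero. Its
  -- coefficient at `j₀` is a polynomial in z, nonzero because its own coefficient at `i₀` is.
  let B := Algebra.adjoin ℂ ({z, h} : Set WeylAlgebra)
  have hBcomm : IsMulCommutative B := Algebra.isMulCommutative_adjoin ℂ hcomm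
  let _ : CommRing B := { (inferInstance : Ring B) with mul_comm := hBcomm.1.1 }
  have : IsDomain B := NoZeroDivisors.to_isDomain _
  let zB : B := ⟨z, Algebra.subset_adjoin (by simp)⟩
  let hB : B := ⟨h, Algebra.subset_adjoin (by simp)⟩
  have hval : ∀ p : ℂ[X], aeval z p = B.val (aeval zB p) := fun p => aeval_algHom_apply B.val zB p
  let P : B[X] := ∑ j : Fin N, C (aeval zB (G j k₀)) * X ^ (j : ℕ)
  have hP : P = 0 := by
    refine eq_zero_of_infinite_isRoot P
      (Set.infinite_of_injective_forall_mem (f := fun n : ℕ => hB + algebraMap ℂ B (2 * n)) ?_ ?_)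
    · intro m n hmn
      have := (algebraMap ℂ B).injective (add_left_cancel hmn)
      simpa using this
    · intro n
      apply Subtype.ext
      have := hshift n
      rw [Algebra.smul_def, mul_one] at this
      change B.val (P.eval _) = 0
      simp only [P, eval_finsetSum, eval_mul, eval_C, eval_pow, eval_X, map_sum, map_mul, map_pow,
        map_add, ← hval]
      rw [map_mul] at this
      exact this
  refine mem_degLT_one_of_isAlgebraic ⟨G j₀ k₀, fun h0 => ?_, ?_⟩
  · have := congrArg (fun p => coeff p (i₀ : ℕ)) h0
    simp only [G, finsetSum_coeff, coeff_C_mul, coeff_X_pow, Fin.val_inj, mul_ite, mul_one,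
      mul_zero, Finset.sum_ite_eq, Finset.mem_univ, if_true, coeff_zero] at this
    exact hne this
  · have := congrArg (fun p => coeff p (j₀ : ℕ)) hP
    simp only [P, finsetSum_coeff, coeff_C_mul, coeff_X_pow, Fin.val_inj, mul_ite, mul_one,
      mul_zero, Finset.sum_ite_eq, Finset.mem_univ, if_true, coeff_zero] at this
    rw [hval, this, map_zero]

end WeylAlgebra

/-! ### Semisimple subalgebras have rank one -/

section Complex

open LieAlgebra LieAlgebra.IsKilling LieModule

variable {L : Type*} [LieRing L] [LieAlgebra ℂ L]

/-- The image of z is a scalar, so z is central, and the center is trivial. -/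
theorem WeylAlgebra.eq_zero_of_lie_eq_zero {ψ : L →ₗ⁅ℂ⁆ WeylAlgebra} (hψ : Function.Injective ψ)
    [HasTrivialRadical ℂ L] {e h z : L} (he0 : e ≠ 0) (he : ⁅h, e⁆ = (2 : ℂ) • e)
    (hze : ⁅z, e⁆ = 0) (hzh : ⁅z, h⁆ = 0) : z = 0 := by
  have comm : ∀ {x y : L}, ⁅x, y⁆ = 0 → Commute (ψ x) (ψ y) := fun {x y} hxy => by
    have := congrArg ψ hxy
    rwa [LieHom.map_lie, map_zero, LieRing.of_associative_ring_bracket, sub_eq_zero] at this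
  have h1 := congrArg ψ he
  rw [LieHom.map_lie, map_smul, LieRing.of_associative_ring_bracket, sub_eq_iff_eq_add] at h1
  have h2 : (2 : WeylAlgebra) = (2 : ℂ) • 1 := by
    rw [← Algebra.algebraMap_eq_smul_one, map_ofNat]
  have hz := mem_degLT_one_of_commute (e := ψ e) (h := ψ h) (z := ψ z)
    (by rwa [Ne, map_eq_zero_iff ψ hψ]) (by rw [h1, mul_add, h2, mul_smul_comm, mul_one, add_comm])
    (comm hze) (comm hzh)
  obtain ⟨c, hc⟩ := mem_degLT_one_iff.1 hz
  have hcen : z ∈ center ℂ L := by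
    rw [LieModule.mem_maxTrivSubmodule]
    intro x
    apply hψ
    rw [LieHom.map_lie, map_zero, LieRing.of_associative_ring_bracket, ← hc,
      Algebra.commutes, sub_self]
  simpa using hcen

variable [FiniteDimensional ℂ L]

theorem WeylAlgebra.finrank_eq_three [Nontrivial L] [IsKilling ℂ L] {ψ : L →ₗ⁅ℂ⁆ WeylAlgebra}
    (hψ : Function.Injective ψ) : Module.finrank ℂ L = 3 := by
  obtain ⟨x, hx⟩ := exists_isCartanSubalgebra_engel ℂ L
  set H := LieSubalgebra.engel ℂ x
  -- there is a nonzero root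
  obtain ⟨α, hα⟩ : ∃ α : Weight ℂ H L, α.IsNonZero := by
    by_contra! hno
    -- If every weight vanished, L would be its zero root space, which is the abelian subalgebra H.
    have hHtop : ∀ z : L, z ∈ H := by
      intro z
      have hz : z ∈ (⨆ β : Weight ℂ H L, genWeightSpace L β).toSubmodule := by
        rw [iSup_genWeightSpace_eq_top' ℂ H L]; trivial
      rw [LieSubmodule.iSup_toSubmodule] at hz
      refine (iSup_le fun β => ?_ : _ ≤ H.toSubmodule) hz
      have hβ : (β : H → ℂ) = 0 := hno β
      rw [hβ]
      exact (congrArg LieSubmodule.toSubmodule (rootSpace_zero_eq ℂ L H)).le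
    have hab : IsLieAbelian L := ⟨fun y z =>
      congrArg Subtype.val (trivial_lie_zero H H ⟨y, hHtop y⟩ ⟨z, hHtop z⟩)⟩
    exact not_subsingleton L ((isLieAbelian_iff_subsingleton ℂ L).1 hab)
  obtain ⟨h, e, f, t, heα, hfα⟩ := exists_isSl2Triple_of_weight_isNonZero hα
  have hh : h = coroot α := t.h_eq_coroot hα heα hfα
  -- An element of H killed by α commutes with both e and h. Hence H is spanned by the coroot, every
  -- root is proportional to α, and the only roots are α and -α.
  have hker : ∀ z : H, α z = 0 → z = 0 := by
    intro z hz
    have := WeylAlgebra.eq_zero_of_lie_eq_zero hψ (e := e) (h := h) (z := z) t.e_ne_zero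
      (t.lie_h_e_smul ℂ)
      (by simpa [hz] using lie_eq_smul_of_mem_rootSpace heα z)
      (by
        rw [hh, ← LieSubalgebra.coe_bracket, trivial_lie_zero]; rfl)
    exact Subtype.ext this
  have hH : ∀ z : H, (2 : ℂ) • z = α z • coroot α := by
    intro z
    rw [← sub_eq_zero]
    apply hker
    rw [← Weight.toLinear_apply, map_sub, map_smul, map_smul, Weight.toLinear_apply,
      Weight.toLinear_apply, root_apply_coroot hα, smul_eq_mul, smul_eq_mul, mul_comm, sub_self]
  have hspan : ∀ β : Weight ℂ H L, (rootSpace H β).toSubmodule ≤ Submodule.span ℂ {h, e, f} := by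
    intro β
    by_cases hβ : β.IsZero
    · intro z hz
      rw [show (β : H → ℂ) = 0 from hβ, rootSpace_zero_eq] at hz
      have h2 := congrArg Subtype.val (hH ⟨z, hz⟩)
      have h3 : z = (α ⟨z, hz⟩ / 2) • h := by
        have h4 : (2 : ℂ) • z = α ⟨z, hz⟩ • (coroot α : L) := h2
        rw [div_eq_inv_mul, mul_smul, hh, ← h4, inv_smul_smul₀ two_ne_zero]
      rw [h3]
      exact Submodule.smul_mem _ _ (Submodule.subset_span (by simp))
    · have hβα : (β : H → ℂ) = (β (coroot α) / 2) • α := by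
        funext z
        have := congrArg β.toLinear (hH z)
        rw [map_smul, map_smul] at this
        simp at this ⊢
        linear_combination this / 2
      rcases eq_neg_or_eq_of_eq_smul α β hβ _ hβα with rfl | rfl
      · intro z hz
        obtain ⟨c, hc⟩ := (finrank_eq_one_iff_of_nonzero'
          (⟨f, hfα⟩ : rootSpace H (-α : Weight ℂ H L))
          (fun h0 => t.f_ne_zero (congrArg Subtype.val h0))).1
          (finrank_rootSpace_eq_one _ hβ) ⟨z, hz⟩
        rw [← show c • f = z from congrArg Subtype.val hc]
        exact Submodule.smul_mem _ _ (Submodule.subset_span (by simp))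
      · intro z hz
        obtain ⟨c, hc⟩ := (finrank_eq_one_iff_of_nonzero' (⟨e, heα⟩ : rootSpace H β)
          (fun h0 => t.e_ne_zero (congrArg Subtype.val h0))).1
          (finrank_rootSpace_eq_one _ hβ) ⟨z, hz⟩
        rw [← show c • e = z from congrArg Subtype.val hc]
        exact Submodule.smul_mem _ _ (Submodule.subset_span (by simp))
  have htop : Submodule.span ℂ ({h, e, f} : Set L) = ⊤ := by
    rw [eq_top_iff]
    have := congrArg LieSubmodule.toSubmodule (iSup_genWeightSpace_eq_top' ℂ H L)
    rw [LieSubmodule.iSup_toSubmodule, LieSubmodule.top_toSubmodule] at this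
    rw [← this]
    exact iSup_le hspan
  have hli : LinearIndependent ℂ ![h, e, f] := by
    refine Module.End.eigenvectors_linearIndependent' (ad ℂ L h) ![0, 2, -2] ?_ _ ?_
    · intro i j
      fin_cases i <;> fin_cases j <;> norm_num
    · intro i
      rw [Module.End.hasEigenvector_iff, Module.End.mem_eigenspace_iff]
      fin_cases i
      · simpa using t.h_ne_zero
      · simpa using ⟨t.lie_h_e_smul ℂ, t.e_ne_zero⟩
      · simpa [two_smul] using
          ⟨by rw [t.lie_h_f_nsmul, two_smul, neg_add], t.f_ne_zero⟩
  have hb := Module.Basis.mk hli (by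
    rw [Matrix.range_cons, Matrix.range_cons_cons_empty, Set.singleton_union, htop])
  simpa using Module.finrank_eq_card_basis hb

end Complex

/-! ### Complexifying a real realization -/

section Real

open scoped TensorProduct

variable {g : Type*} [LieRing g] [LieAlgebra ℝ g]

theorem exists_tmul_add_I_tmul (z : ℂ ⊗[ℝ] g) :
    ∃ x y : g, z = 1 ⊗ₜ x + Complex.I ⊗ₜ y := by
  induction z using TensorProduct.induction_on with
  | zero => exact ⟨0, 0, by simp⟩
  | tmul c x =>
    refine ⟨c.re • x, c.im • x, ?_⟩
    rw [← TensorProduct.smul_tmul, ← TensorProduct.smul_tmul, ← TensorProduct.add_tmul]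
    congr 1
    apply Complex.ext <;> simp
  | add z w hz hw =>
    obtain ⟨x, y, rfl⟩ := hz
    obtain ⟨x', y', rfl⟩ := hw
    exact ⟨x + x', y + y', by rw [TensorProduct.tmul_add, TensorProduct.tmul_add]; abel⟩

theorem isKilling_complexification [FiniteDimensional ℝ g] [LieAlgebra.IsKilling ℝ g] :
    LieAlgebra.IsKilling ℂ (ℂ ⊗[ℝ] g) where
  killingCompl_top_eq_bot := by
    rw [eq_bot_iff]
    intro z hz
    rw [LieIdeal.mem_killingCompl] at hz
    obtain ⟨x, y, rfl⟩ := exists_tmul_add_I_tmul z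
    -- Pairing with the real vector 1 ⊗ w separates real and imaginary parts.
    have key : ∀ w, killingForm ℝ g w x = 0 ∧ killingForm ℝ g w y = 0 := by
      intro w
      have := hz (1 ⊗ₜ w) trivial
      rw [killingForm, LieModule.traceForm_baseChange] at this
      simp only [map_add, LinearMap.BilinForm.baseChange_tmul] at this
      simpa [Complex.ext_iff] using this
    have h0 : ∀ x, (∀ w, killingForm ℝ g w x = 0) → x = 0 := fun x hx =>
      (LieAlgebra.IsKilling.killingForm_nondegenerate ℝ g).2 x hx
    rw [h0 x fun w => (key w).1, h0 y fun w => (key w).2]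
    simp

/-- The complex linear extension of a realization. -/
noncomputable def complexifiedRealization (Φ : g →ₗ⁅ℝ⁆ SkewWeyl) : ℂ ⊗[ℝ] g →ₗ⁅ℂ⁆ WeylAlgebra :=
  { TensorProduct.AlgebraTensorModule.lift
      ((LinearMap.toSpanSingleton ℂ (g →ₗ[ℝ] WeylAlgebra)
        (SkewWeyl.toSubmodule.subtype ∘ₗ (Φ : g →ₗ[ℝ] SkewWeyl)))) with
    map_lie' := by
      intro z w
      have key : ∀ (c : ℂ) (x : g), TensorProduct.AlgebraTensorModule.lift
          ((LinearMap.toSpanSingleton ℂ (g →ₗ[ℝ] WeylAlgebra)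
            (SkewWeyl.toSubmodule.subtype ∘ₗ (Φ : g →ₗ[ℝ] SkewWeyl)))) (c ⊗ₜ x) =
            c • (Φ x : WeylAlgebra) := fun c x => rfl
      simp only [AddHom.toFun_eq_coe, LinearMap.coe_toAddHom]
      induction z using TensorProduct.induction_on with
      | zero => simp
      | add z z' hz hz' => rw [add_lie, map_add, map_add, add_lie, hz, hz']
      | tmul c x =>
        induction w using TensorProduct.induction_on with
        | zero => simp
        | add w w' hw hw' => rw [lie_add, map_add, map_add, lie_add, hw, hw']
        | tmul d y =>
          rw [LieAlgebra.ExtendScalars.bracket_tmul, key, key, key, LieHom.map_lie,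
            LieSubalgebra.coe_bracket, smul_lie, lie_smul, smul_smul] }

theorem complexifiedRealization_tmul (Φ : g →ₗ⁅ℝ⁆ SkewWeyl) (c : ℂ) (x : g) :
    complexifiedRealization Φ (c ⊗ₜ x) = c • (Φ x : WeylAlgebra) := rfl

theorem star_coe_skewWeyl (x : SkewWeyl) : star (x : WeylAlgebra) = -x := x.2

/-- If Φ x + i Φ y = 0, applying the dagger changes the sign of the first term only, so both vanish.
-/
theorem complexifiedRealization_injective {Φ : g →ₗ⁅ℝ⁆ SkewWeyl} (hΦ : Function.Injective Φ) :
    Function.Injective (complexifiedRealization Φ) := by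
  rw [← LieHom.coe_toLinearMap, ← LinearMap.ker_eq_bot, LinearMap.ker_eq_bot']
  intro z hz
  obtain ⟨x, y, rfl⟩ := exists_tmul_add_I_tmul z
  rw [LieHom.coe_toLinearMap, map_add, complexifiedRealization_tmul, complexifiedRealization_tmul,
    one_smul] at hz
  have hz' := congrArg star hz
  rw [star_add, star_smul, star_coe_skewWeyl, star_coe_skewWeyl, star_zero, Complex.star_def,
    Complex.conj_I, neg_smul, smul_neg, neg_neg] at hz'
  have h0 : ∀ w : WeylAlgebra, w + w = 0 → w = 0 := fun w hw => by
    rw [← two_smul ℂ] at hw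
    exact (smul_eq_zero.1 hw).resolve_left two_ne_zero
  have hy : Complex.I • (Φ y : WeylAlgebra) = 0 := by
    apply h0
    calc _ = ((Φ x : WeylAlgebra) + Complex.I • (Φ y : WeylAlgebra)) +
          (-(Φ x : WeylAlgebra) + Complex.I • (Φ y : WeylAlgebra)) := by abel
      _ = 0 := by rw [hz, hz', add_zero]
  rw [hy, add_zero] at hz
  have hx0 : x = 0 := hΦ (Subtype.ext (by rw [hz, map_zero]; rfl))
  have hy0 : y = 0 := hΦ (Subtype.ext (by
    rw [(smul_eq_zero.1 hy).resolve_left Complex.I_ne_zero, map_zero]; rfl))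
  simp [hx0, hy0]

theorem finrank_eq_three_of_faithfullyRealizable [FiniteDimensional ℝ g] [Nontrivial g]
    [LieAlgebra.IsKilling ℝ g] (hg : FaithfullyRealizable g) : Module.finrank ℝ g = 3 := by
  obtain ⟨Φ, hΦ⟩ := hg
  have := isKilling_complexification (g := g)
  have h := WeylAlgebra.finrank_eq_three (complexifiedRealization_injective hΦ)
  rwa [Module.finrank_baseChange] at h

end Real

/-! ### The compact case -/

namespace WeylAlgebra

/-- `A₁` contains no nonzero skew-hermitian elements with the brackets of `𝔰𝔲(2)`. -/
theorem eq_zero_of_compact {x : Fin 3 → WeylAlgebra} (hx : ∀ i, star (x i) = -x i)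
    {c : Fin 3 → ℝ} (hc : ∀ i, 0 < c i) (h01 : ⁅x 0, x 1⁆ = (c 2 : ℂ) • x 2)
    (h12 : ⁅x 1, x 2⁆ = (c 0 : ℂ) • x 0) (h20 : ⁅x 2, x 0⁆ = (c 1 : ℂ) • x 1) : x 2 = 0 := by
  by_contra hx2
  -- The Casimir element: the weights `c i` make it commute with every `x i`.
  set Ω : WeylAlgebra := ∑ i, (c i : ℂ) • (x i * x i) with hΩ
  rw [Fin.sum_univ_three] at hΩ
  have h10 : ⁅x 1, x 0⁆ = -((c 2 : ℂ) • x 2) := by rw [← lie_skew, h01]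
  have h02 : ⁅x 0, x 2⁆ = -((c 1 : ℂ) • x 1) := by rw [← lie_skew, h20]
  have leib : ∀ y u : WeylAlgebra, ⁅y, u * u⁆ = ⁅y, u⁆ * u + u * ⁅y, u⁆ := fun y u => by
    simp only [LieRing.of_associative_ring_bracket]; noncomm_ring
  have hΩ0 : ⁅x 0, Ω⁆ = 0 := by
    rw [hΩ]
    simp only [lie_add, lie_smul, leib, lie_self, h01, h02, smul_mul_assoc, mul_smul_comm, neg_mul,
      mul_neg, zero_mul, mul_zero]
    module
  have hΩ1 : ⁅x 1, Ω⁆ = 0 := by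
    rw [hΩ]
    simp only [lie_add, lie_smul, leib, lie_self, h10, h12, smul_mul_assoc, mul_smul_comm, neg_mul,
      mul_neg, zero_mul, mul_zero]
    module
  have hΩ2 : Commute (x 2) Ω := by
    have h := leibniz_lie (x 0) (x 1) Ω
    rw [hΩ1, hΩ0, h01, lie_zero, lie_zero, add_zero, smul_lie] at h
    have := (smul_eq_zero.1 h.symm).resolve_left (by exact_mod_cast (hc 2).ne')
    rwa [LieRing.of_associative_ring_bracket, sub_eq_zero] at this
  have hΩ0' : Commute (x 0) Ω := sub_eq_zero.1 hΩ0
  have hΩ1' : Commute (x 1) Ω := sub_eq_zero.1 hΩ1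
  -- An eigenvalue of ad x₀ on the span of x₁ and x₂, with eigenvector e below; rescaling x₀ by 2 /
  -- μ gives the pair required by `mem_degLT_one_of_commute`.
  set μ : ℂ := Complex.I * (Real.sqrt (c 1 * c 2) : ℝ) with hμ
  have hpos : 0 < c 1 * c 2 := mul_pos (hc 1) (hc 2)
  have hμ2 : μ * μ = -(c 1 * c 2 : ℂ) := by
    have : ((Real.sqrt (c 1 * c 2) : ℝ) : ℂ) * (Real.sqrt (c 1 * c 2) : ℝ) = (c 1 * c 2 : ℂ) := by
      exact_mod_cast Real.mul_self_sqrt hpos.le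
    rw [hμ, mul_mul_mul_comm, Complex.I_mul_I, this, neg_one_mul]
  have hμ0 : μ ≠ 0 := by
    rw [hμ]
    exact mul_ne_zero Complex.I_ne_zero (by exact_mod_cast (Real.sqrt_pos.2 hpos).ne')
  have hμs : star μ = -μ := by simp [hμ]
  set e : WeylAlgebra := μ • x 1 + (c 2 : ℂ) • x 2 with he
  -- As μ is imaginary, μ x₁ is hermitian, so e - e† = 2 c₂ x₂.
  have he0 : e ≠ 0 := by
    intro h0
    have h1 : star e = 0 := by rw [h0, star_zero]
    rw [he, star_add, star_smul, star_smul, hx, hx, hμs, Complex.star_def, Complex.conj_ofReal,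
      smul_neg, smul_neg, neg_smul, neg_neg] at h1
    have h2 : (2 * c 2 : ℂ) • x 2 = 0 := by
      calc _ = (μ • x 1 + (c 2 : ℂ) • x 2) - (μ • x 1 + -((c 2 : ℂ) • x 2)) := by module
        _ = 0 := by rw [← he, h0, h1, sub_zero]
    refine hx2 ((smul_eq_zero.1 h2).resolve_left (mul_ne_zero two_ne_zero ?_))
    exact_mod_cast (hc 2).ne'
  have hlie : ⁅x 0, e⁆ = μ • e := by
    rw [he, lie_add, lie_smul, lie_smul, h01, h02, smul_add, smul_smul μ μ, hμ2]
    module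
  have hΩs : Ω ∈ degLT 1 := by
    refine mem_degLT_one_of_commute (e := e) (h := (2 / μ) • x 0) he0 ?_ ?_ ?_
    · have h1 : ⁅(2 / μ) • x 0, e⁆ = (2 : ℂ) • e := by
        rw [smul_lie, hlie, smul_smul, div_mul_cancel₀ _ hμ0]
      rw [LieRing.of_associative_ring_bracket, sub_eq_iff_eq_add] at h1
      have h2 : (2 : WeylAlgebra) = (2 : ℂ) • 1 := by
        rw [← Algebra.algebraMap_eq_smul_one, map_ofNat]
      rw [h1, mul_add, h2, mul_smul_comm, mul_smul_comm, mul_one, add_comm]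
    · exact ((hΩ1'.symm.smul_right _).add_right (hΩ2.symm.smul_right _))
    · exact hΩ0'.symm.smul_right _
  -- With yᵢ = √cᵢ xᵢ skew-hermitian, ∑ yᵢ yᵢ† = -Ω.
  have hscal := mem_degLT_one_of_sum_mul_star Finset.univ
    (fun i => ((Real.sqrt (c i) : ℝ) : ℂ) • x i) (by
      have : ∑ i, ((Real.sqrt (c i) : ℝ) : ℂ) • x i * star (((Real.sqrt (c i) : ℝ) : ℂ) • x i) =
          -Ω := by
        rw [← Finset.sum_neg_distrib]
        refine Finset.sum_congr rfl fun i _ => ?_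
        have : ((Real.sqrt (c i) : ℝ) : ℂ) * (Real.sqrt (c i) : ℝ) = c i := by
          exact_mod_cast Real.mul_self_sqrt (hc i).le
        rw [star_smul, hx, Complex.star_def, Complex.conj_ofReal, smul_mul_smul_comm, this, mul_neg,
          smul_neg]
      rw [this]
      exact neg_mem hΩs)
  obtain ⟨s, hs⟩ := mem_degLT_one_iff.1 (hscal 0 (Finset.mem_univ _))
  have h0 : ⁅((Real.sqrt (c 0) : ℝ) : ℂ) • x 0, x 1⁆ = 0 := by
    rw [LieRing.of_associative_ring_bracket, ← hs, Algebra.commutes, sub_self]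
  rw [smul_lie, h01, smul_smul] at h0
  refine hx2 ((smul_eq_zero.1 h0).resolve_left (mul_ne_zero ?_ ?_))
  · exact_mod_cast (Real.sqrt_pos.2 (hc 0)).ne'
  · exact_mod_cast (hc 2).ne'

end WeylAlgebra

/-- The bracket relations of `𝔰𝔲(2)` have no faithful realization. -/
theorem not_faithfullyRealizable_of_compact {g : Type*} [LieRing g] [LieAlgebra ℝ g]
    {x : Fin 3 → g} (hx : x 2 ≠ 0) {c : Fin 3 → ℝ} (hc : ∀ i, 0 < c i)
    (h01 : ⁅x 0, x 1⁆ = c 2 • x 2) (h12 : ⁅x 1, x 2⁆ = c 0 • x 0) (h20 : ⁅x 2, x 0⁆ = c 1 • x 1) :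
    ¬ FaithfullyRealizable g := by
  rintro ⟨Φ, hΦ⟩
  have key : ∀ {i j k : Fin 3}, ⁅x i, x j⁆ = c k • x k →
      ⁅(Φ (x i) : WeylAlgebra), (Φ (x j) : WeylAlgebra)⁆ = (c k : ℂ) • (Φ (x k) : WeylAlgebra) :=
    fun {i j k} h => by
      rw [← LieSubalgebra.coe_bracket, ← LieHom.map_lie, h, map_smul, Complex.coe_smul]; rfl
  have := WeylAlgebra.eq_zero_of_compact (x := fun i => (Φ (x i) : WeylAlgebra))
    (fun i => star_coe_skewWeyl _) hc (key h01) (key h12) (key h20)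
  exact hx (hΦ (Subtype.ext (by rw [this, map_zero]; rfl)))

theorem not_faithfullyRealizable_SU2 : ¬ FaithfullyRealizable SU2 := by
  -- The Pauli matrices times i, ordered so that the cyclic brackets carry the positive constant 2.
  let x : Fin 3 → SU2 :=
    ![⟨!![Complex.I, 0; 0, -Complex.I], by
        constructor <;> simp [← Matrix.ext_iff, Matrix.trace_fin_two, Fin.forall_fin_two]⟩,
      ⟨!![0, 1; -1, 0], by
        constructor <;> simp [← Matrix.ext_iff, Matrix.trace_fin_two, Fin.forall_fin_two]⟩,
      ⟨!![0, Complex.I; Complex.I, 0], by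
        constructor <;> simp [← Matrix.ext_iff, Matrix.trace_fin_two, Fin.forall_fin_two]⟩]
  refine not_faithfullyRealizable_of_compact (x := x) (c := fun _ => 2) ?_ (fun _ => two_pos)
    ?_ ?_ ?_
  · intro h
    have := congrFun (congrFun (congrArg Subtype.val h) 0) 1
    simp [x] at this
  all_goals
    apply Subtype.ext
    rw [LieSubalgebra.coe_bracket, LieRing.of_associative_ring_bracket]
    ext i j
    fin_cases i <;> fin_cases j <;> simp [x, Complex.ext_iff] <;> norm_num

theorem not_faithfullyRealizable_SL2C : ¬ FaithfullyRealizable SL2C := by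
  rintro ⟨Φ, hΦ⟩
  have hle : SU2 ≤ SL2C := fun M hM => hM.2
  exact not_faithfullyRealizable_SU2 ⟨Φ.comp (LieSubalgebra.inclusion hle),
    hΦ.comp (LieSubalgebra.inclusion_injective hle)⟩

/-! ### The Lie algebra `𝔰𝔩(2, ℝ)` -/

namespace SL2R

/-- The traceless matrix with the given entries. -/
def mk (p q r : ℝ) : SL2R :=
  ⟨!![p, q; r, -p], by
    change Matrix.trace (!![p, q; r, -p]) = 0
    simp [Matrix.trace_fin_two]⟩

theorem coe_mk (p q r : ℝ) : (mk p q r : Matrix (Fin 2) (Fin 2) ℝ) = !![p, q; r, -p] := rfl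

theorem exists_eq_mk (x : SL2R) : ∃ p q r, x = mk p q r := by
  obtain ⟨M, hM⟩ := x
  have h : M.trace = 0 := hM
  rw [Matrix.trace_fin_two] at h
  refine ⟨M 0 0, M 0 1, M 1 0, Subtype.ext ?_⟩
  rw [coe_mk]
  ext i j
  fin_cases i <;> fin_cases j <;> simp
  linarith

theorem mk_lie_mk (p q r p' q' r' : ℝ) : ⁅mk p q r, mk p' q' r'⁆ =
    mk (q * r' - r * q') (2 * (p * q' - q * p')) (2 * (r * p' - p * r')) := by
  apply Subtype.ext
  rw [LieSubalgebra.coe_bracket, LieRing.of_associative_ring_bracket, coe_mk, coe_mk, coe_mk]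
  ext i j
  fin_cases i <;> fin_cases j <;> simp <;> ring

theorem smul_mk (c p q r : ℝ) : c • mk p q r = mk (c * p) (c * q) (c * r) := by
  apply Subtype.ext
  change c • !![p, q; r, -p] = !![_, _; _, _]
  ext i j
  fin_cases i <;> fin_cases j <;> simp

theorem mk_add_mk (p q r p' q' r' : ℝ) :
    mk p q r + mk p' q' r' = mk (p + p') (q + q') (r + r') := by
  apply Subtype.ext
  change !![p, q; r, -p] + !![p', q'; r', -p'] = !![_, _; _, _]
  ext i j
  fin_cases i <;> fin_cases j <;> simp [add_comm]

theorem mk_eq_zero_iff {p q r : ℝ} : mk p q r = 0 ↔ p = 0 ∧ q = 0 ∧ r = 0 := by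
  constructor
  · intro h
    have h' : !![p, q; r, -p] = 0 := congrArg Subtype.val h
    exact ⟨congrFun (congrFun h' 0) 0, congrFun (congrFun h' 0) 1, congrFun (congrFun h' 1) 0⟩
  · rintro ⟨rfl, rfl, rfl⟩
    apply Subtype.ext
    change !![(0 : ℝ), 0; 0, -0] = 0
    ext i j
    fin_cases i <;> fin_cases j <;> simp

theorem ideal_eq_top {I : LieIdeal ℝ SL2R} (hI : I ≠ ⊥) : I = ⊤ := by
  obtain ⟨x, hx, hx0⟩ := (Submodule.ne_bot_iff I.toSubmodule).1
    (by rwa [Ne, LieSubmodule.toSubmodule_eq_bot])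
  obtain ⟨p, q, r, rfl⟩ := exists_eq_mk x
  have scale : ∀ (c : ℝ) {p q r p' q' r' : ℝ}, mk p q r ∈ I → c * p = p' → c * q = q' →
      c * r = r' → mk p' q' r' ∈ I := by
    rintro c p q r _ _ _ h rfl rfl rfl
    rw [← smul_mk]; exact I.smul_mem c h
  -- The bracket with the raising matrix, taken zero, one or two times, turns any nonzero element
  -- into a nonzero multiple of that matrix.
  have he : mk 0 1 0 ∈ I := by
    have h1 : ⁅mk 0 1 0, mk p q r⁆ ∈ I := lie_mem_right ℝ SL2R I _ _ hx
    have h2 := lie_mem_right ℝ SL2R I (mk 0 1 0) _ h1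
    rw [mk_lie_mk] at h1
    rw [mk_lie_mk, mk_lie_mk] at h2
    by_cases hr : r = 0
    · by_cases hp : p = 0
      · subst hr hp
        have hq : q ≠ 0 := fun h => hx0 (mk_eq_zero_iff.2 ⟨rfl, h, rfl⟩)
        exact scale q⁻¹ hx (by simp) (by field_simp) (by simp)
      · exact scale (-(2 * p)⁻¹) h1 (by simp [hr]) (by field_simp; ring) (by simp)
    · exact scale (-(2 * r)⁻¹) h2 (by simp) (by field_simp; ring) (by simp)
  have hh : mk 1 0 0 ∈ I := by
    have h1 : ⁅mk 0 0 (-1), mk 0 1 0⁆ ∈ I := lie_mem_right ℝ SL2R I _ _ he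
    rw [mk_lie_mk] at h1
    exact scale 1 h1 (by simp) (by simp) (by simp)
  have hf : mk 0 0 1 ∈ I := by
    have h1 : ⁅mk 0 0 1, mk 1 0 0⁆ ∈ I := lie_mem_right ℝ SL2R I _ _ hh
    rw [mk_lie_mk] at h1
    exact scale (1 / 2) h1 (by simp) (by simp) (by simp)
  rw [eq_top_iff]
  intro y _
  obtain ⟨p, q, r, rfl⟩ := exists_eq_mk y
  have h := I.add_mem (I.add_mem (I.smul_mem p hh) (I.smul_mem q he)) (I.smul_mem r hf)
  rw [smul_mk, smul_mk, smul_mk, mk_add_mk, mk_add_mk] at h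
  simpa using h

instance : LieAlgebra.IsSimple ℝ SL2R where
  eq_bot_or_eq_top I := or_iff_not_imp_left.2 ideal_eq_top
  non_abelian h := by
    have h1 := h.trivial (mk 0 1 0) (mk 0 0 1)
    rw [mk_lie_mk, mk_eq_zero_iff] at h1
    simp at h1

end SL2R

/-! ### The realization by quadratic elements -/

namespace SkewWeyl

/-- The image of `diag(1, -1)`. -/
noncomputable def quadH : SkewWeyl :=
  ⟨(1 / 2 : ℂ) • (WeylAlgebra.a ^ 2 - WeylAlgebra.aDag ^ 2), by
    change star _ = -_
    simp [star_smul, WeylAlgebra.star_a, WeylAlgebra.star_aDag, ← smul_neg]⟩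

/-- The image of the raising matrix. -/
noncomputable def quadE : SkewWeyl :=
  ⟨(Complex.I / 4) • (WeylAlgebra.a + WeylAlgebra.aDag) ^ 2, by
    change star _ = -_
    simp [star_smul, WeylAlgebra.star_a, WeylAlgebra.star_aDag, add_comm, neg_div]⟩

/-- The image of the lowering matrix. -/
noncomputable def quadF : SkewWeyl :=
  ⟨(Complex.I / 4) • (WeylAlgebra.a - WeylAlgebra.aDag) ^ 2, by
    change star _ = -_
    have h : (WeylAlgebra.aDag - WeylAlgebra.a) ^ 2 = (WeylAlgebra.a - WeylAlgebra.aDag) ^ 2 := by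
      rw [← neg_sub, neg_sq]
    simp [star_smul, WeylAlgebra.star_a, WeylAlgebra.star_aDag, h, neg_div]⟩

/-- Up to constants, s = a + a† and d = a - a† are position and momentum. Their commutator is
constant, so quadratic expressions close under the bracket; h is (sd + ds) / 4. -/
theorem quad_relations_aux {A : Type*} [Ring A] [Algebra ℂ A] {s d h : A}
    (hds : d * s = s * d + (2 : ℂ) • 1) (hh : h = (1 / 2 : ℂ) • (s * d + 1)) :
    ⁅(Complex.I / 4) • s ^ 2, (Complex.I / 4) • d ^ 2⁆ = h ∧
    ⁅h, (Complex.I / 4) • s ^ 2⁆ = (2 : ℂ) • (Complex.I / 4) • s ^ 2 ∧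
    ⁅h, (Complex.I / 4) • d ^ 2⁆ = (-2 : ℂ) • (Complex.I / 4) • d ^ 2 := by
  have hds' : ∀ x : A, d * (s * x) = s * (d * x) + (2 : ℂ) • x := fun x => by
    rw [← mul_assoc, hds, add_mul, smul_mul_assoc, one_mul, mul_assoc]
  have h1 : ⁅s ^ 2, d ^ 2⁆ = (-8 : ℂ) • (s * d + 1) := by
    simp only [LieRing.of_associative_ring_bracket, pow_two, mul_assoc, hds, hds', mul_add,
      mul_smul_comm, mul_one]
    module
  have h2 : ⁅s * d + 1, s ^ 2⁆ = (4 : ℂ) • s ^ 2 := by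
    simp only [LieRing.of_associative_ring_bracket, pow_two, mul_assoc, hds, hds', mul_add,
      add_mul, mul_smul_comm, mul_one, one_mul]
    module
  have h3 : ⁅s * d + 1, d ^ 2⁆ = (-4 : ℂ) • d ^ 2 := by
    simp only [LieRing.of_associative_ring_bracket, pow_two, mul_assoc, hds', mul_add,
      add_mul, mul_smul_comm, mul_one, one_mul]
    module
  refine ⟨?_, ?_, ?_⟩
  · rw [smul_lie, lie_smul, h1, hh, smul_smul, smul_smul]
    congr 1
    linear_combination (-1 / 2 : ℂ) * Complex.I_mul_I
  · rw [hh, smul_lie, lie_smul, h2, smul_smul, smul_smul, smul_smul]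
    congr 1
    ring
  · rw [hh, smul_lie, lie_smul, h3, smul_smul, smul_smul, smul_smul]
    congr 1
    ring

open WeylAlgebra in
theorem quad_relations : ⁅quadE, quadF⁆ = quadH ∧ ⁅quadH, quadE⁆ = (2 : ℝ) • quadE ∧
    ⁅quadH, quadF⁆ = (-2 : ℝ) • quadF := by
  have hc : ∀ (c : ℝ) (x : SkewWeyl),
      ((c • x : SkewWeyl) : WeylAlgebra) = (c : ℂ) • (x : WeylAlgebra) :=
    fun c x => (Complex.coe_smul c _).symm
  have hds : (a - aDag) * (a + aDag) = (a + aDag) * (a - aDag) + (2 : ℂ) • 1 := by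
    rw [two_smul]
    simp only [mul_add, sub_mul, add_mul, mul_sub, a_mul_aDag]
    abel
  obtain ⟨h1, h2, h3⟩ := quad_relations_aux (h := (1 / 2 : ℂ) • (a ^ 2 - aDag ^ 2)) hds (by
    simp only [pow_two, add_mul, mul_sub, a_mul_aDag]
    congr 1
    abel)
  refine ⟨Subtype.ext h1, Subtype.ext ?_, Subtype.ext ?_⟩
  · rw [hc]; push_cast; exact h2
  · rw [hc]; push_cast; exact h3

theorem quadH_ne_zero : quadH ≠ 0 := by
  intro h
  have h1 : (1 / 2 : ℂ) • (WeylAlgebra.a ^ 2 - WeylAlgebra.aDag ^ 2) = 0 := congrArg Subtype.val h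
  have h2 := (smul_eq_zero.1 h1).resolve_left (by norm_num)
  have h3 : (0, 2) = ((2, 0) : ℕ × ℕ) := WeylAlgebra.linearIndependent_monomial.injective (by
    simpa [sub_eq_zero] using h2)
  simp at h3

end SkewWeyl

open SkewWeyl in
theorem faithfullyRealizable_SL2R : FaithfullyRealizable SL2R := by
  obtain ⟨hef, hhe, hhf⟩ := quad_relations
  have hfe : ⁅quadF, quadE⁆ = -quadH := by rw [← lie_skew, hef]
  have heh : ⁅quadE, quadH⁆ = -((2 : ℝ) • quadE) := by rw [← lie_skew, hhe]
  have hfh : ⁅quadF, quadH⁆ = -((-2 : ℝ) • quadF) := by rw [← lie_skew, hhf]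
  let φ : SL2R → SkewWeyl := fun M => M.1 0 0 • quadH + M.1 0 1 • quadE + M.1 1 0 • quadF
  have hφ : ∀ p q r, φ (SL2R.mk p q r) = p • quadH + q • quadE + r • quadF := fun _ _ _ => rfl
  let Φ : SL2R →ₗ⁅ℝ⁆ SkewWeyl :=
    { toFun := φ
      map_add' := fun x y => by
        obtain ⟨p, q, r, rfl⟩ := SL2R.exists_eq_mk x
        obtain ⟨p', q', r', rfl⟩ := SL2R.exists_eq_mk y
        rw [SL2R.mk_add_mk, hφ, hφ, hφ]
        module
      map_smul' := fun c x => by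
        obtain ⟨p, q, r, rfl⟩ := SL2R.exists_eq_mk x
        rw [SL2R.smul_mk, hφ, hφ, RingHom.id_apply]
        module
      map_lie' := fun {x y} => by
        obtain ⟨p, q, r, rfl⟩ := SL2R.exists_eq_mk x
        obtain ⟨p', q', r', rfl⟩ := SL2R.exists_eq_mk y
        rw [SL2R.mk_lie_mk, hφ, hφ, hφ]
        simp only [lie_add, add_lie, smul_lie, lie_smul, lie_self, hef, hhe, hhf, hfe, heh, hfh]
        module }
  refine ⟨Φ, ?_⟩
  -- The kernel is an ideal, so it would be everything and contain diag(1, -1), whose image is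
  -- nonzero.
  rw [← LieHom.ker_eq_bot]
  by_contra hne
  have h1 : SL2R.mk 1 0 0 ∈ Φ.ker := by rw [SL2R.ideal_eq_top hne]; trivial
  have h2 : φ (SL2R.mk 1 0 0) = 0 := h1
  rw [hφ] at h2
  exact quadH_ne_zero (by simpa using h2)

/-! ### Real Lie algebras of dimension three -/

theorem map_lie_of_basis {L M : Type*} [LieRing L] [LieAlgebra ℝ L] [LieRing M]
    [LieAlgebra ℝ M] (v : Module.Basis (Fin 3) ℝ L) (f : L →ₗ[ℝ] M) (h01 : f ⁅v 0, v 1⁆ = ⁅f (v 0), f (v 1)⁆)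
    (h12 : f ⁅v 1, v 2⁆ = ⁅f (v 1), f (v 2)⁆) (h20 : f ⁅v 2, v 0⁆ = ⁅f (v 2), f (v 0)⁆) (x y : L) :
    f ⁅x, y⁆ = ⁅f x, f y⁆ := by
  have skew : ∀ {i j}, f ⁅v i, v j⁆ = ⁅f (v i), f (v j)⁆ → f ⁅v j, v i⁆ = ⁅f (v j), f (v i)⁆ :=
    fun {i j} h => by rw [← lie_skew, map_neg, h, lie_skew]
  have hv : ∀ i j, f ⁅v i, v j⁆ = ⁅f (v i), f (v j)⁆ := by
    intro i j
    fin_cases i <;> fin_cases j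
    · simp
    · exact h01
    · exact skew h20
    · exact skew h01
    · simp
    · exact h12
    · exact h20
    · exact skew h12
    · simp
  rw [← v.sum_repr x, ← v.sum_repr y]
  simp only [Fin.sum_univ_three, lie_add, add_lie, smul_lie, lie_smul, map_add, map_smul, hv]

/-- A three-dimensional real Lie algebra whose Killing form has signature `(2, 1)` is `𝔰𝔩(2, ℝ)`. -/
theorem nonempty_equiv_SL2R {g : Type*} [LieRing g] [LieAlgebra ℝ g]
    (v : Module.Basis (Fin 3) ℝ g) {l0 l1 l2 τ : ℝ} (h0 : 0 < l0) (h1 : 0 < l1) (h2 : l2 < 0)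
    (hτ : l0 * l1 * l2 = -2 * τ ^ 2) (h01 : ⁅v 0, v 1⁆ = (τ / l2) • v 2)
    (h12 : ⁅v 1, v 2⁆ = (τ / l0) • v 0) (h20 : ⁅v 2, v 0⁆ = (τ / l1) • v 1) :
    Nonempty (g ≃ₗ⁅ℝ⁆ SL2R) := by
  have hτ0 : τ ≠ 0 := by
    rintro rfl
    have := mul_ne_zero (mul_ne_zero h0.ne' h1.ne') h2.ne
    exact this (by rw [hτ]; ring)
  obtain ⟨p, hp, hp2⟩ : ∃ p : ℝ, p ≠ 0 ∧ p ^ 2 = l0 / 8 :=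
    ⟨Real.sqrt (l0 / 8), (Real.sqrt_pos.2 (by positivity)).ne', Real.sq_sqrt (by positivity)⟩
  obtain ⟨q, hq, hq2⟩ : ∃ q : ℝ, q ≠ 0 ∧ q ^ 2 = l1 / 8 :=
    ⟨Real.sqrt (l1 / 8), (Real.sqrt_pos.2 (by positivity)).ne', Real.sq_sqrt (by positivity)⟩
  have hl0 := h0.ne'
  have hl1 := h1.ne'
  have hl2 := h2.ne
  -- The basis goes to p·H, q(E + F) and r(E - F). On sl(2, ℝ) the Killing form is 4 tr(XY), so p² =
  -- l0 / 8 and q² = l1 / 8 match its values; r is forced by the bracket of the first two.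
  set r := 2 * p * q * l2 / τ with hr
  have hr0 : r ≠ 0 := by positivity
  let f : g →ₗ[ℝ] SL2R := v.constr ℝ ![SL2R.mk p 0 0, SL2R.mk 0 q q, SL2R.mk 0 r (-r)]
  have f0 : f (v 0) = SL2R.mk p 0 0 := by simp [f]
  have f1 : f (v 1) = SL2R.mk 0 q q := by simp [f]
  have f2 : f (v 2) = SL2R.mk 0 r (-r) := by simp [f]
  have hlie := map_lie_of_basis v f
    (by
      rw [h01, map_smul, f0, f1, f2, SL2R.smul_mk, SL2R.mk_lie_mk]
      have : τ / l2 * r = 2 * p * q := by rw [hr]; field_simp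
      congr 1
      · ring
      · linear_combination this
      · linear_combination -this)
    (by
      rw [h12, map_smul, f0, f1, f2, SL2R.smul_mk, SL2R.mk_lie_mk]
      have : τ / l0 * p = -(2 * q * r) := by
        rw [hr]
        field_simp
        linear_combination (4 * l0 * l2) * hq2 + hτ / 2
      congr 1
      · linear_combination this
      · ring
      · ring)
    (by
      rw [h20, map_smul, f0, f1, f2, SL2R.smul_mk, SL2R.mk_lie_mk]
      have : τ / l1 * q = -(2 * p * r) := by
        rw [hr]
        field_simp
        linear_combination (4 * l1 * l2) * hp2 + hτ / 2
      congr 1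
      · ring
      · linear_combination this
      · linear_combination this)
  have hf : ∀ x, f x = SL2R.mk (p * v.repr x 0) (q * v.repr x 1 + r * v.repr x 2)
      (q * v.repr x 1 - r * v.repr x 2) := by
    intro x
    conv_lhs => rw [← v.sum_repr x]
    rw [Fin.sum_univ_three, map_add, map_add, map_smul, map_smul, map_smul, f0, f1, f2,
      SL2R.smul_mk, SL2R.smul_mk, SL2R.smul_mk, SL2R.mk_add_mk, SL2R.mk_add_mk]
    congr 1 <;> ring
  have hinj : Function.Injective f := by
    rw [← LinearMap.ker_eq_bot, LinearMap.ker_eq_bot']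
    intro x hx
    rw [hf, SL2R.mk_eq_zero_iff] at hx
    obtain ⟨e0, e1, e2⟩ := hx
    have r0 : v.repr x 0 = 0 := (mul_eq_zero.1 e0).resolve_left hp
    have r1 : v.repr x 1 = 0 :=
      (mul_eq_zero.1 (show q * v.repr x 1 = 0 by linarith)).resolve_left hq
    have r2 : v.repr x 2 = 0 :=
      (mul_eq_zero.1 (show r * v.repr x 2 = 0 by linarith)).resolve_left hr0
    rw [← v.sum_repr x, Fin.sum_univ_three, r0, r1, r2]
    simp
  have hsurj : Function.Surjective f := by
    intro y
    obtain ⟨s, t, u, rfl⟩ := SL2R.exists_eq_mk y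
    refine ⟨(s / p) • v 0 + ((t + u) / (2 * q)) • v 1 + ((t - u) / (2 * r)) • v 2, ?_⟩
    rw [map_add, map_add, map_smul, map_smul, map_smul, f0, f1, f2, SL2R.smul_mk, SL2R.smul_mk,
      SL2R.smul_mk, SL2R.mk_add_mk, SL2R.mk_add_mk]
    congr 1 <;> field_simp <;> ring
  exact ⟨{ LinearEquiv.ofBijective f ⟨hinj, hsurj⟩ with map_lie' := fun {x y} => hlie x y }⟩

/-! ### Killing form signatures in dimension three -/

section

variable {g : Type*} [LieRing g] [LieAlgebra ℝ g] [FiniteDimensional ℝ g]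

/-- The structure constants of a three-dimensional real Lie algebra with nondegenerate Killing
form in an orthogonal basis. -/
theorem exists_orthogonal_basis_killingForm [LieAlgebra.IsKilling ℝ g]
    (h3 : Module.finrank ℝ g = 3) :
    ∃ (v : Module.Basis (Fin 3) ℝ g) (l : Fin 3 → ℝ) (τ : ℝ), (∀ i, l i ≠ 0) ∧
      l 0 * l 1 * l 2 = -2 * τ ^ 2 ∧ ⁅v 0, v 1⁆ = (τ / l 2) • v 2 ∧
      ⁅v 1, v 2⁆ = (τ / l 0) • v 0 ∧ ⁅v 2, v 0⁆ = (τ / l 1) • v 1 := by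
  set κ := killingForm ℝ g with hκ
  obtain ⟨w, hw⟩ := LinearMap.BilinForm.exists_orthogonal_basis
    (LieModule.traceForm_isSymm ℝ g g)
  let v : Module.Basis (Fin 3) ℝ g := w.reindex (finCongr h3)
  have hv : ∀ i j, i ≠ j → κ (v i) (v j) = 0 := fun i j hij => by
    simp only [v, Module.Basis.reindex_apply]
    exact hw (fun h => hij ((finCongr h3).symm.injective h))
  have inv : ∀ x y z, κ ⁅x, y⁆ z = κ x ⁅y, z⁆ := LieModule.traceForm_apply_lie_apply ℝ g g
  have symm : ∀ x y, κ x y = κ y x := LieModule.traceForm_comm ℝ g g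
  have nondeg : ∀ x, (∀ i, κ x (v i) = 0) → x = 0 := fun x hx => by
    refine (LieAlgebra.IsKilling.killingForm_nondegenerate ℝ g).1 x fun y => ?_
    rw [← v.sum_repr y, map_sum]
    exact Finset.sum_eq_zero fun i _ => by rw [map_smul, ← hκ, hx, smul_zero]
  have hl : ∀ i, κ (v i) (v i) ≠ 0 := fun i h0 => v.ne_zero i (nondeg _ fun j => by
    by_cases hij : i = j
    · rw [← hij, h0]
    · exact hv i j hij)
  -- By invariance κ([x, y], z) is alternating, so one number τ fixes every bracket.
  set τ := κ ⁅v 0, v 1⁆ (v 2) with hτ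
  have hτ1 : κ ⁅v 1, v 2⁆ (v 0) = τ := by rw [symm, ← inv]
  have hτ2 : κ ⁅v 2, v 0⁆ (v 1) = τ := by rw [inv, symm]
  have self : ∀ i j, κ ⁅v i, v j⁆ (v j) = 0 := fun i j => by rw [inv, lie_self, map_zero]
  have self' : ∀ i j, κ ⁅v i, v j⁆ (v i) = 0 := fun i j => by
    rw [← lie_skew, map_neg, LinearMap.neg_apply, self, neg_zero]
  have br : ∀ i j k, i ≠ j → j ≠ k → k ≠ i → κ ⁅v i, v j⁆ (v k) = τ →
      ⁅v i, v j⁆ = (τ / κ (v k) (v k)) • v k := by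
    intro i j k hij hjk hki h
    rw [← sub_eq_zero]
    refine nondeg _ fun m => ?_
    rw [map_sub, map_smul, LinearMap.sub_apply, LinearMap.smul_apply, smul_eq_mul]
    obtain rfl | rfl | rfl : m = i ∨ m = j ∨ m = k := by omega
    · rw [self', hv _ _ hki]; simp
    · rw [self, hv _ _ hjk.symm]; simp
    · rw [h, div_mul_cancel₀ _ (hl _), sub_self]
  have b01 := br 0 1 2 (by decide) (by decide) (by decide) rfl
  have b12 := br 1 2 0 (by decide) (by decide) (by decide) hτ1
  have b20 := br 2 0 1 (by decide) (by decide) (by decide) hτ2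
  refine ⟨v, fun i => κ (v i) (v i), τ, hl, ?_, b01, b12, b20⟩
  have b02 : ⁅v 0, v 2⁆ = -((τ / κ (v 1) (v 1)) • v 1) := by rw [← lie_skew, b20]
  -- The Killing form must be the trace of (ad v₀)², which ties τ to the diagonal values.
  have htr : κ (v 0) (v 0) = -2 * (τ / κ (v 1) (v 1)) * (τ / κ (v 2) (v 2)) := by
    rw [hκ, killingForm_apply_apply, LinearMap.trace_eq_matrix_trace ℝ v, Matrix.trace,
      Fin.sum_univ_three]
    simp only [Matrix.diag_apply, LinearMap.toMatrix_apply, LinearMap.comp_apply,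
      LieAlgebra.ad_apply, lie_self, b01, b02, map_zero, map_neg, map_smul,
      Finsupp.zero_apply, Finsupp.neg_apply, Finsupp.smul_apply, Module.Basis.repr_self,
      Finsupp.single_eq_same, smul_eq_mul, ← hκ]
    ring
  have h1 := hl 1
  have h2 := hl 2
  simp only
  rw [htr]
  field_simp

theorem nonempty_equiv_SL2R_of_faithfullyRealizable [Nontrivial g] [LieAlgebra.IsSemisimple ℝ g]
    (hg : FaithfullyRealizable g) : Nonempty (g ≃ₗ⁅ℝ⁆ SL2R) := by
  obtain ⟨v, l, τ, hl, hτ, h01, h12, h20⟩ :=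
    exists_orthogonal_basis_killingForm (finrank_eq_three_of_faithfullyRealizable hg)
  have hneg : l 0 * l 1 * l 2 < 0 := by
    refine lt_of_le_of_ne ?_ (mul_ne_zero (mul_ne_zero (hl 0) (hl 1)) (hl 2))
    rw [hτ]
    nlinarith [sq_nonneg τ]
  have hτ0 : τ ≠ 0 := by
    rintro rfl
    rw [hτ] at hneg
    simp at hneg
  have r0 : v.reindex (finRotate 3) 0 = v 2 := by
    rw [Module.Basis.reindex_apply]; rfl
  have r1 : v.reindex (finRotate 3) 1 = v 0 := by
    rw [Module.Basis.reindex_apply]; rfl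
  have r2 : v.reindex (finRotate 3) 2 = v 1 := by
    rw [Module.Basis.reindex_apply]; rfl
  have s0 : v.reindex (finRotate 3).symm 0 = v 1 := by
    rw [Module.Basis.reindex_apply]; rfl
  have s1 : v.reindex (finRotate 3).symm 1 = v 2 := by
    rw [Module.Basis.reindex_apply]; rfl
  have s2 : v.reindex (finRotate 3).symm 2 = v 0 := by
    rw [Module.Basis.reindex_apply]; rfl
  rcases (hl 0).lt_or_gt with n0 | p0 <;> rcases (hl 1).lt_or_gt with n1 | p1 <;>
    rcases (hl 2).lt_or_gt with n2 | p2
  · exfalso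
    have hln : ∀ i, l i < 0 := by
      intro i
      fin_cases i
      exacts [n0, n1, n2]
    -- Rescaling by -τ turns the constants τ / lᵢ, whose sign depends on τ, into τ² / (-lᵢ) > 0.
    refine not_faithfullyRealizable_of_compact (x := fun i => (-τ) • v i)
      (c := fun i => τ ^ 2 / -l i) (smul_ne_zero (neg_ne_zero.2 hτ0) (v.ne_zero 2))
      (fun i => div_pos (by positivity) (neg_pos.2 (hln i))) ?_ ?_ ?_ hg
    all_goals
      simp only [smul_lie, lie_smul, h01, h12, h20, smul_smul]
      congr 1
      rw [div_neg]
      ring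
  · exact absurd hneg (mul_pos (mul_pos_of_neg_of_neg n0 n1) p2).not_gt
  · exact absurd hneg (mul_pos_of_neg_of_neg (mul_neg_of_neg_of_pos n0 p1) n2).not_gt
  -- A cyclic rotation keeps the bracket relations and moves the negative vector to the last place.
  · exact nonempty_equiv_SL2R (v.reindex (finRotate 3).symm) p1 p2 n0
      (by rw [← hτ]; ring)
      (by rw [s0, s1, s2, h12]) (by rw [s0, s1, s2, h20]) (by rw [s0, s1, s2, h01])
  · exact absurd hneg (mul_pos_of_neg_of_neg (mul_neg_of_pos_of_neg p0 n1) n2).not_gt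
  · exact nonempty_equiv_SL2R (v.reindex (finRotate 3)) p2 p0 n1
      (by rw [← hτ]; ring)
      (by rw [r0, r1, r2, h20]) (by rw [r0, r1, r2, h01]) (by rw [r0, r1, r2, h12])
  · exact nonempty_equiv_SL2R v p0 p1 n2 hτ h01 h12 h20
  · exact absurd hneg (mul_pos (mul_pos p0 p1) p2).not_gt

end

theorem mainTheorem7 :
    (∀ (𝔤 : Type*) [LieRing 𝔤] [LieAlgebra ℝ 𝔤] [FiniteDimensional ℝ 𝔤],
      (Nontrivial 𝔤 ∧ LieAlgebra.IsSemisimple ℝ 𝔤 ∧ FaithfullyRealizable 𝔤) ↔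
        Nonempty (𝔤 ≃ₗ⁅ℝ⁆ SL2R)) ∧
    FaithfullyRealizable SL2R ∧
    ¬ FaithfullyRealizable SU2 ∧
    ¬ FaithfullyRealizable SL2C := by
  refine ⟨fun 𝔤 _ _ _ => ⟨?_, ?_⟩, faithfullyRealizable_SL2R, not_faithfullyRealizable_SU2,
    not_faithfullyRealizable_SL2C⟩
  · rintro ⟨_, _, h⟩
    exact nonempty_equiv_SL2R_of_faithfullyRealizable h
  · rintro ⟨e⟩
    -- Semisimplicity crosses the isomorphism as nondegeneracy of the Killing form.
    have := LieAlgebra.isKilling_of_equiv e.symm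
    obtain ⟨Φ, hΦ⟩ := faithfullyRealizable_SL2R
    have hsl : Nontrivial SL2R := LieAlgebra.IsSimple.nontrivial ℝ SL2R
    exact ⟨e.surjective.nontrivial, inferInstance, Φ.comp e.toLieHom, hΦ.comp e.injective⟩
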